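/- \textbf{Theorem (Intrinsic fault-tolerant gate bound, multi-block case).} \emph{Setting.} For a family $\mathcal X=\{(X_\lambda,d_\lambda)\}_{\lambda\in I}$ of metric spaces (the value $d_\lambda=\infty$ is allowed) let $\dim_{\mathrm{Assouad}}(\mathcal X)\in[0,\infty]$ be the infimum of all $s\ge 0$ for which there is a constant $C>0$ such that for all $\lambda\in I$, $x\in X_\lambda$ and $0<r<R$ the closed ball of radius $R$ about $x$ is covered by at most $C(R/r)^s$ closed balls of radius $r$. Let $\{C_\lambda\}_{\lambda\in I}$ be a family of stabilizer codes on finite sets $V_\lambda$ of qubits with specified generating sets $\mathcal S_\lambda$ (commuting Pauli operators, $-1\notin\langle\mathcal S_\lambda\rangle$; the generators need not be independent). The connectivity graph $G_\lambda$ has vertex set $V_\lambda$, two distinct qubits being adjacent if some generator acts non-trivially on both; assume that each $G_\lambda$ is connected. Let $d(C_\lambda)$ be the code distance, i.e. the least weight of a Pauli operator that commutes with $\mathcal S_\lambda$ and does not belong, up to a phase, to $\langle\mathcal S_\lambda\rangle$ ($\infty$ if there is none). Let $\beta\in[0,\infty]$ be the intrinsic dimension of the family, i.e. the Assouad dimension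 of $\{G_\lambda\}$ with the path metrics. Let $K\ge1$ and consider $C_\lambda^{\otimes K}$ on the qubits $(j,v)$, $1\le j\le K$, $v\in V_\lambda$. Let $\mathcal G=\{\mathcal G_\lambda\}$ be a \emph{graph-local} family of sets of unitary gates on one block: for some $\eta$ independent of $\lambda$, any two qubits in the support of a gate of $\mathcal G_\lambda$ have distance at most $\eta$ in $G_\lambda$. Let $\mathcal G'=\{\mathcal G'_\lambda\}$ be a family of sets of unitary cross-block gates on the $K$ blocks, each acting non-trivially on at least two blocks. Let $\widetilde G_\lambda$ consist of the $K$ copies of $G_\lambda$, whose edges have weight $1$, together with a virtual edge between $(i,x)$ and $(j,y)$, of weight $d_{G_\lambda}(x,y)+1$, whenever $i\ne j$ and both qubits lie in the support of a common gate of $\mathcal G'_\lambda$. Equip $\widetilde G_\lambda$ with its weighted path metric. Assume that $\mathcal G'$ is \emph{virtually graph-local}: the weights of all virtual edges are bounded by a constant independent of $\lambda$. (Translation invariance of $\mathcal G'$ is not needed.) The Clifford hierarchy on $m$ qubits is as follows: $\mathcal P_1$ is the Pauli group with phases $\pm1,\pm i$, and for $\ell\ge2$, $\mathcal P_\ell=\{U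 \text{ unitary}: UPU^\dagger\in\mathcal P_{\ell-1}\text{ for all }P\in\mathcal P_1\}$; by convention $\mathcal P_0$ consists of the global phases. \emph{Conclusion.} \begin{enumerate} \item $\dim_{\mathrm{Assouad}}(\{\widetilde G_\lambda\}_{\lambda\in I})=\beta$. \item Suppose $\beta<\infty$. For every depth $h$ there is a constant $d_0$ such that for all $\lambda$ with $d(C_\lambda)\ge d_0$ the following holds. Let $U$ be a product of at most $h$ layers, each a product of gates with pairwise disjoint supports, taken from $\mathcal G'_\lambda$ and the copies of $\mathcal G_\lambda$ in the $K$ blocks. If $U$ preserves the code space of $C_\lambda^{\otimes K}$, then for every encoding isometry $E$ of $m$ logical qubits onto that code space under which each logical Pauli operator is implemented by a physical Pauli operator, the logical gate $L=E^\dagger UE$ belongs, up to a global phase, to $\mathcal P_{\lfloor\beta\rfloor}$. In particular, if $d(C_\lambda)\to\infty$, every logical gate implemented by constant-depth circuits lies in the $\lfloor\beta\rfloor$-th level for all sufficiently large $\lambda$. \end{enumerate} -/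

import Mathlib

open scoped ENNReal NNReal

namespace QCode

noncomputable section

/-! ### Assouad dimension of a family of (extended) metric spaces -/

section Assouad

variable {I : Type*} {X : I → Type*}

/-- The uniform covering condition with exponent `s`: there is one constant `C`, valid for all
members of the family, all centres and all scales `0 < r < R`, such that every closed ball of
radius `R` is covered by at most `C * (R / r) ^ s` closed balls of radius `r`. -/
def IsCoveringExponent (d : ∀ i, X i → X i → ℝ≥0∞) (s : ℝ≥0) : Prop :=
  ∃ C : ℝ, 0 < C ∧ ∀ (i : I) (x : X i) (r R : ℝ), 0 < r → r < R →
    ∃ F : Finset (X i), (F.card : ℝ) ≤ C * (R / r) ^ (s : ℝ) ∧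
      ∀ y : X i, d i x y ≤ ENNReal.ofReal R → ∃ z ∈ F, d i z y ≤ ENNReal.ofReal r

/-- The Assouad dimension of a family of spaces: the infimum of all covering exponents
(`∞` if there is none). -/
def assouadDim (d : ∀ i, X i → X i → ℝ≥0∞) : ℝ≥0∞ :=
  ⨅ (s : ℝ≥0) (_ : IsCoveringExponent d s), (s : ℝ≥0∞)

end Assouad

/-! ### Weighted path metrics -/

section Weighted

variable {W : Type*}

/-- The total weight of a walk. -/
def walkWeight {G : SimpleGraph W} (w : W → W → ℕ) {u v : W} (p : G.Walk u v) : ℕ :=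
  (p.darts.map fun e => w e.fst e.snd).sum

/-- The weighted path distance: the least weight of a walk (`∞` if there is no walk). -/
def weightedDist (G : SimpleGraph W) (w : W → W → ℕ) (u v : W) : ℝ≥0∞ :=
  ⨅ p : G.Walk u v, (walkWeight w p : ℝ≥0∞)

end Weighted

/-! ### Operators on a register of qubits -/

/-- Operators on the Hilbert space `(ℂ²)^{⊗ Q}`, as matrices in the computational basis. -/
abbrev QOp (Q : Type*) := Matrix (Q → Fin 2) (Q → Fin 2) ℂ

/-- `M` acts trivially on the qubit `q`, that is, `M = M' ⊗ 1_q`. -/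
def ActsTriviallyAt {Q : Type*} [DecidableEq Q] (M : QOp Q) (q : Q) : Prop :=
  ∀ a b : Q → Fin 2,
    (a q ≠ b q → M a b = 0) ∧
    (a q = b q → ∀ t : Fin 2, M (Function.update a q t) (Function.update b q t) = M a b)

/-- The support of an operator: the qubits on which it acts non-trivially. -/
def support {Q : Type*} [DecidableEq Q] (M : QOp Q) : Set Q :=
  {q | ¬ ActsTriviallyAt M q}

/-- The single-qubit Pauli matrices `1, X, Y, Z`. -/
def pauliMatrix : Fin 4 → Matrix (Fin 2) (Fin 2) ℂ :=
  ![1, !![0, 1; 1, 0], !![0, -Complex.I; Complex.I, 0], !![1, 0; 0, -1]]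

/-- The tensor product of single-qubit Pauli matrices. -/
def pauliString {Q : Type*} [Fintype Q] (σ : Q → Fin 4) : QOp Q :=
  Matrix.of fun a b => ∏ q, pauliMatrix (σ q) (a q) (b q)

/-- The phases `1, -1, i, -i`. -/
def pauliPhases : Set ℂ := {1, -1, Complex.I, -Complex.I}

/-- The Pauli group on the qubits `Q`, with the phases `±1, ±i`. -/
def pauliGroup (Q : Type*) [Fintype Q] : Set (QOp Q) :=
  {P | ∃ c ∈ pauliPhases, ∃ σ : Q → Fin 4, P = c • pauliString σ}

/-- The levels of the Clifford hierarchy. Level `1` is the Pauli group, and level `ℓ ≥ 2` consists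
of the unitaries that conjugate every Pauli operator into level `ℓ - 1`. By convention level `0`
consists of the global phases. -/
def cliffordLevel (Q : Type*) [Fintype Q] [DecidableEq Q] : ℕ → Set (QOp Q)
  | 0 => {U | ∃ c : ℂ, ‖c‖ = 1 ∧ U = c • (1 : QOp Q)}
  | 1 => pauliGroup Q
  | (l + 2) => {U | U ∈ Matrix.unitaryGroup (Q → Fin 2) ℂ ∧
      ∀ P ∈ pauliGroup Q, U * P * U.conjTranspose ∈ cliffordLevel Q (l + 1)}

/-! ### Stabilizer codes -/

section Stabilizer

variable {Q : Type*} [Fintype Q] [DecidableEq Q]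

/-- `S` generates a stabilizer group: it consists of pairwise commuting Pauli operators and
does not generate `-1`. (Pauli operators have finite order, so the monoid generated by `S` is the
group generated by `S`.) The generators need not be independent. -/
def IsStabilizerGeneratingSet (S : Set (QOp Q)) : Prop :=
  S ⊆ pauliGroup Q ∧ (∀ s ∈ S, ∀ t ∈ S, s * t = t * s) ∧ (-1 : QOp Q) ∉ Submonoid.closure S

/-- The code space: the common `+1` eigenspace of the stabilizers. -/
def codeSpace (S : Set (QOp Q)) : Submodule ℂ ((Q → Fin 2) → ℂ) where
  carrier := {ψ | ∀ s ∈ S, s.mulVec ψ = ψ}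
  zero_mem' := fun s _ => Matrix.mulVec_zero s
  add_mem' := fun {x y} hx hy s hs => by rw [Matrix.mulVec_add, hx s hs, hy s hs]
  smul_mem' := fun c x hx s hs => by rw [Matrix.mulVec_smul, hx s hs]

/-- The nontrivial logical Pauli operators: those that commute with all stabilizers and are not,
up to a phase, stabilizers themselves. -/
def nontrivialLogicals (S : Set (QOp Q)) : Set (QOp Q) :=
  {P | P ∈ pauliGroup Q ∧ (∀ s ∈ S, s * P = P * s) ∧
    ∀ c ∈ pauliPhases, c • P ∉ Submonoid.closure S}

/-- The code distance: the least weight of a nontrivial logical operator (`∞` if there is none,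
that is, if no logical qubit is encoded). -/
def codeDistance (S : Set (QOp Q)) : ℕ∞ :=
  ⨅ P ∈ nontrivialLogicals S, (support P).encard

/-- The connectivity graph of a generating set: two distinct qubits are adjacent if some generator
acts non-trivially on both. -/
def connectivityGraph (S : Set (QOp Q)) : SimpleGraph Q where
  Adj u v := u ≠ v ∧ ∃ s ∈ S, u ∈ support s ∧ v ∈ support s
  symm := ⟨fun _ _ h => ⟨h.1.symm, h.2.imp fun _ h' => ⟨h'.1, h'.2.2, h'.2.1⟩⟩⟩
  loopless := ⟨fun _ h => h.1 rfl⟩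

/-- An encoding of `m` logical qubits: an isometry of `(ℂ²)^{⊗ m}` onto the code space under which
every logical Pauli operator is implemented by a physical Pauli operator. -/
def IsEncoding (S : Set (QOp Q)) {m : ℕ} (E : Matrix (Q → Fin 2) (Fin m → Fin 2) ℂ) : Prop :=
  E.conjTranspose * E = 1 ∧
  LinearMap.range (Matrix.toLin' E) = codeSpace S ∧
  ∀ P ∈ pauliGroup (Fin m), ∃ P' ∈ pauliGroup Q, P' * E = E * P

/-- `U` is a logical gate: a unitary that preserves the code space. -/
def IsLogicalGate (S : Set (QOp Q)) (U : QOp Q) : Prop :=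
  U ∈ Matrix.unitaryGroup (Q → Fin 2) ℂ ∧ (codeSpace S).map (Matrix.toLin' U) = codeSpace S

/-- The action of `U` on the logical qubits of the encoding `E`. -/
def logicalAction {m : ℕ} (E : Matrix (Q → Fin 2) (Fin m → Fin 2) ℂ) (U : QOp Q) : QOp (Fin m) :=
  E.conjTranspose * U * E

/-! ### Circuits -/

/-- One layer: a product of gates from `𝒢` with pairwise disjoint supports. -/
def IsLayer (𝒢 : Set (QOp Q)) (U : QOp Q) : Prop :=
  ∃ gs : List (QOp Q), (∀ g ∈ gs, g ∈ 𝒢) ∧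
    gs.Pairwise (fun g h => Disjoint (support g) (support h)) ∧ U = gs.prod

/-- `U` is realized by a circuit over `𝒢` with at most `h` layers. -/
def IsCircuit (𝒢 : Set (QOp Q)) (h : ℕ) (U : QOp Q) : Prop :=
  ∃ Ls : List (QOp Q), Ls.length ≤ h ∧ (∀ L ∈ Ls, IsLayer 𝒢 L) ∧ U = Ls.prod

end Stabilizer

/-! ### Several blocks. The qubit `(j, v)` is the copy of the qubit `v` in block `j`. -/

section Blocks

variable {V : Type*} [Fintype V] [DecidableEq V] {K : ℕ}

/-- The operator `M` acting on block `j`, tensored with the identity on all other blocks. -/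
def blockOp (j : Fin K) (M : QOp V) : QOp (Fin K × V) :=
  Matrix.of fun a b =>
    if ∀ q : Fin K × V, q.1 ≠ j → a q = b q then M (fun v => a (j, v)) (fun v => b (j, v)) else 0

/-- The copies in all `K` blocks of a set of operators on one block. Applied to a generating set of
the code `C`, this is a generating set of the `K`-fold code `C^{⊗ K}`. -/
def blockCopies (K : ℕ) (S : Set (QOp V)) : Set (QOp (Fin K × V)) :=
  {M | ∃ j : Fin K, ∃ s ∈ S, M = blockOp j s}

/-- A virtual edge joins two qubits in different blocks that lie in the support of a common
cross-block gate. -/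
def IsVirtualEdge (𝒢' : Set (QOp (Fin K × V))) (p q : Fin K × V) : Prop :=
  p.1 ≠ q.1 ∧ ∃ g ∈ 𝒢', p ∈ support g ∧ q ∈ support g

/-- `K` disjoint copies of the graph `G`, together with the virtual edges. -/
def multiBlockGraph (G : SimpleGraph V) (𝒢' : Set (QOp (Fin K × V))) :
    SimpleGraph (Fin K × V) where
  Adj p q := (p.1 = q.1 ∧ G.Adj p.2 q.2) ∨ IsVirtualEdge 𝒢' p q
  symm := ⟨fun _ _ h => h.imp (fun h' => ⟨h'.1.symm, h'.2.symm⟩)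
    (fun h' => ⟨h'.1.symm, h'.2.imp fun _ k => ⟨k.1, k.2.2, k.2.1⟩⟩)⟩
  loopless := ⟨fun _ h => h.elim (fun h' => G.loopless.irrefl _ h'.2) (fun h' => h'.1 rfl)⟩

/-- Edges inside a block have weight `1`; a virtual edge from `(i, x)` to `(j, y)`, `i ≠ j`, has
weight `d_G(x, y) + 1`. -/
def edgeWeight (G : SimpleGraph V) (p q : Fin K × V) : ℕ :=
  if p.1 = q.1 then 1 else G.dist p.2 q.2 + 1

/-- The weighted path metric of the multi-block graph. -/
def multiBlockDist (G : SimpleGraph V) (𝒢' : Set (QOp (Fin K × V))) :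
    Fin K × V → Fin K × V → ℝ≥0∞ :=
  weightedDist (multiBlockGraph G 𝒢') (edgeWeight G)

/-- All gates available on `K` blocks: the single-block gates `𝒢`, on any block, and the
cross-block gates `𝒢'`. -/
def multiBlockGates (𝒢 : Set (QOp V)) (𝒢' : Set (QOp (Fin K × V))) : Set (QOp (Fin K × V)) :=
  blockCopies K 𝒢 ∪ 𝒢'

end Blocks

/-! ### Families of codes -/

section Families

variable {I : Type*} {V : I → Type*} [∀ i, Fintype (V i)] [∀ i, DecidableEq (V i)]

/-- The intrinsic dimension of a family of codes with specified generating sets: the Assouad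
dimension of the family of connectivity graphs with their path metrics. -/
def intrinsicDim (S : ∀ i, Set (QOp (V i))) : ℝ≥0∞ :=
  assouadDim fun i u v => (((connectivityGraph (S i)).edist u v : ℕ∞) : ℝ≥0∞)

/-- The Assouad dimension of the family of multi-block connectivity graphs. -/
def multiBlockIntrinsicDim {K : ℕ} (S : ∀ i, Set (QOp (V i)))
    (𝒢' : ∀ i, Set (QOp (Fin K × V i))) : ℝ≥0∞ :=
  assouadDim fun i => multiBlockDist (connectivityGraph (S i)) (𝒢' i)

/-- A family of sets of unitary gates is graph-local: any two qubits in the support of a gate are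
joined in the connectivity graph by a path of length at most `η`, uniformly in the family. -/
def IsGraphLocal (S 𝒢 : ∀ i, Set (QOp (V i))) : Prop :=
  (∀ i, ∀ g ∈ 𝒢 i, g ∈ Matrix.unitaryGroup (V i → Fin 2) ℂ) ∧
  ∃ η : ℕ, ∀ i, ∀ g ∈ 𝒢 i, ∀ u ∈ support g, ∀ v ∈ support g,
    (connectivityGraph (S i)).edist u v ≤ η

/-- A family of sets of unitary cross-block gates (each acting on at least two blocks) is virtually
graph-local: the weights of all virtual edges are at most `η`, uniformly in the family. -/
def IsVirtuallyGraphLocal {K : ℕ} (S : ∀ i, Set (QOp (V i)))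
    (𝒢' : ∀ i, Set (QOp (Fin K × V i))) : Prop :=
  (∀ i, ∀ g ∈ 𝒢' i, g ∈ Matrix.unitaryGroup (Fin K × V i → Fin 2) ℂ ∧
    ∃ p ∈ support g, ∃ q ∈ support g, p.1 ≠ q.1) ∧
  ∃ η : ℕ, ∀ i, ∀ p q, IsVirtualEdge (𝒢' i) p q →
    edgeWeight (connectivityGraph (S i)) p q ≤ η

end Families

end

end QCode

/-! Dimension. Projecting the multi-block graph to one block does not increase distances, because a
virtual edge is weighted by at least the distance that it projects to, while every walk in the block
graph lifts to any chosen block at equal weight. Covers of one space therefore give covers of the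
other, with constants differing at most by the factor `K`; hence `multiBlockIntrinsicDim_eq`.

Gates. The argument is of Bravyi–König type. Put `l = ⌊β⌋`. Since `β < l + 1`, the vertices of each
graph are covered by `l + 1` sets, each of which splits into uniformly bounded, well separated
pieces (`exists_uniform_fragmented_cover`). The volume growth of balls alone gives this:
`exists_separator` removes from a set a thin separator of minimal size, and iterating on the
separator lowers the growth by a factor `N` each time.

Take the separation so large that even the `b`-neighbourhoods of the pieces share no generator. A
logical Pauli operator over such a neighbourhood factors into logical operators on single pieces and
single blocks. Each has weight below the code distance, hence is a stabilizer, so the region is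
correctable (`Fragmented.correctable`). By the cleaning lemma `Correctable.exists_clean`, every
logical Pauli operator can then be represented off that region.

A circuit of depth `h` spreads supports, projected to one block, by a bounded amount
(`hasRange_circuit`). If `U` lives over `l + 1` of the regions and `P` is cleaned off a
neighbourhood of the last one, the commutator `U P U† P†` lives over the first `l` and has twice the
range. After `l` commutators a single region remains, and an operator there commutes with
representatives of all logical Pauli operators, so it acts as a phase. This is
`mem_commutatorLevel_of_supportedOn`. The commutator hierarchy is compared with the Clifford
hierarchy, up to a phase, in `exists_smul_mem_cliffordLevel`. -/

namespace QCode

/-! ### Fragmented sets in graphs of slow growth -/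

section Fragmented

variable {V : Type*}

/-- `B` splits into labelled pieces, each in the ball of radius `R` about its label, and distinct
pieces are at distance more than `p`. -/
def Fragmented (G : SimpleGraph V) (p R : ℕ) (B : Set V) : Prop :=
  ∃ f : V → V, (∀ u ∈ B, G.dist (f u) u ≤ R) ∧
    ∀ u ∈ B, ∀ v ∈ B, f u ≠ f v → p < G.dist u v

theorem Fragmented.mono {G : SimpleGraph V} {p R R' : ℕ} {B : Set V} (h : Fragmented G p R B)
    (hR : R ≤ R') : Fragmented G p R' B := by
  obtain ⟨f, h1, h2⟩ := h
  exact ⟨f, fun u hu => (h1 u hu).trans hR, h2⟩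

/-- The part of `A` in the closed ball of radius `r` about `x`. -/
noncomputable def ballIn (G : SimpleGraph V) (A : Finset V) (x : V) (r : ℕ) : Finset V :=
  {y ∈ A | G.dist x y ≤ r}

/-- Emptying the annulus of width `p` around a ball isolates that ball, which can then be filled
completely and become a piece labelled `x`. An old piece that already has the label `x` merges with
it harmlessly, since both lie within `R` of `x`. This is the exchange move against which a minimal
separator is tested. -/
theorem Fragmented.swap {G : SimpleGraph V} (hG : G.Connected) {p R r : ℕ} {B : Set V}
    (h : Fragmented G p R B) (hr : r ≤ R) (x : V) :
    Fragmented G p R ({y | y ∈ B ∧ r + p < G.dist x y} ∪ {y | G.dist x y ≤ r}) := by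
  classical
  obtain ⟨f, h1, h2⟩ := h
  refine ⟨fun u => if G.dist x u ≤ r then x else f u, ?_, ?_⟩
  · rintro u (⟨hu, hu'⟩ | hu)
    · have : ¬ G.dist x u ≤ r := by omega
      simpa [this] using h1 u hu
    · have : G.dist x u ≤ r := hu
      simpa [this] using this.trans hr
  · intro u hu v hv huv
    have htri := hG.dist_triangle (u := x) (v := u) (w := v)
    have htri' := hG.dist_triangle (u := x) (v := v) (w := u)
    have hsymm : G.dist v u = G.dist u v := SimpleGraph.dist_comm
    simp only [Set.mem_union, Set.mem_ofPred_eq] at hu hv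
    by_cases hxu : G.dist x u ≤ r <;> by_cases hxv : G.dist x v ≤ r
    · simp [hxu, hxv] at huv
    · rcases hv with hv | hv <;> omega
    · rcases hu with hu | hu <;> omega
    · simp only [hxu, hxv, if_false] at huv
      rcases hu with hu | hu
      · rcases hv with hv | hv
        · exact h2 u hu.1 v hv.1 huv
        · omega
      · omega

/-- A separator of minimal size is small in every ball. -/
theorem exists_separator [DecidableEq V] {G : SimpleGraph V} (hG : G.Connected) (A : Finset V) (p N r : ℕ) :
    ∃ Z ⊆ A, Fragmented G p (r + N * p) (A \ Z : Finset V) ∧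
      ∀ x, N * (ballIn G Z x r).card ≤ (ballIn G A x (r + N * p)).card := by
  classical
  set F : Finset (Finset V) :=
    {Z ∈ A.powerset | Fragmented G p (r + N * p) (A \ Z : Finset V)} with hF
  have hne : F.Nonempty := by
    refine ⟨A, ?_⟩
    simp only [hF, Finset.mem_filter, Finset.mem_powerset, subset_rfl, true_and]
    exact ⟨id, by simp, by simp⟩
  obtain ⟨Z, hZF, hmin⟩ := F.exists_min_image Finset.card hne
  simp only [hF, Finset.mem_filter, Finset.mem_powerset] at hZF
  obtain ⟨hZA, hfrag⟩ := hZF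
  refine ⟨Z, hZA, hfrag, fun x => ?_⟩
  -- Competitor for the minimal `Z`: drop its part in the ball of radius `t = r + k * p` and add the
  -- part of `A` in the next annulus of width `p`. By `Fragmented.swap` this still separates, so the
  -- dropped part is no larger than the annulus.
  have key : ∀ k ∈ Finset.range N, (ballIn G Z x r).card ≤
      (ballIn G A x (r + (k + 1) * p)).card - (ballIn G A x (r + k * p)).card := by
    intro k hk
    have hkN : k + 1 ≤ N := Finset.mem_range.1 hk
    have hle : (k + 1) * p ≤ N * p := Nat.mul_le_mul_right p hkN
    set t := r + k * p with ht
    have htp : r + (k + 1) * p = t + p := by rw [ht]; ring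
    set D := ballIn G A x (t + p) \ ballIn G A x t with hD
    have hsub : ballIn G A x t ⊆ ballIn G A x (t + p) := by
      intro y hy
      simp only [ballIn, Finset.mem_filter] at hy ⊢
      exact ⟨hy.1, by omega⟩
    set Z' := (Z \ ballIn G Z x t) ∪ D with hZ'
    have hZ'F : Z' ∈ F := by
      simp only [hF, Finset.mem_filter, Finset.mem_powerset]
      constructor
      · intro y hy
        simp only [hZ', hD, Finset.mem_union, Finset.mem_sdiff, ballIn, Finset.mem_filter] at hy
        rcases hy with hy | hy
        · exact hZA hy.1
        · exact hy.1.1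
      · obtain ⟨f, h1, h2⟩ := hfrag.swap hG (r := t) (by omega) x
        have hinc : ∀ u ∈ ((A \ Z' : Finset V) : Set V),
            u ∈ ({y | y ∈ ((A \ Z : Finset V) : Set V) ∧ t + p < G.dist x y} ∪
              {y | G.dist x y ≤ t} : Set V) := by
          intro u hu
          simp only [hZ', hD, Finset.coe_sdiff, Set.mem_sdiff, Finset.mem_coe, Finset.mem_union,
            Finset.mem_sdiff, ballIn, Finset.mem_filter] at hu
          simp only [Set.mem_union, Set.mem_ofPred_eq, Finset.coe_sdiff, Set.mem_sdiff,
            Finset.mem_coe]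
          by_cases hut : G.dist x u ≤ t
          · exact Or.inr hut
          · refine Or.inl ⟨⟨hu.1, fun huZ => hu.2 (Or.inl ⟨huZ, fun h => hut h.2⟩)⟩, ?_⟩
            by_contra hcon
            exact hu.2 (Or.inr ⟨⟨hu.1, by omega⟩, fun h => hut h.2⟩)
        exact ⟨f, fun u hu => h1 u (hinc u hu),
          fun u hu v hv => h2 u (hinc u hu) v (hinc v hv)⟩
    have hcard := hmin Z' hZ'F
    have h1 : Z'.card ≤ (Z \ ballIn G Z x t).card + D.card := Finset.card_union_le _ _
    have h2 : (Z \ ballIn G Z x t).card = Z.card - (ballIn G Z x t).card :=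
      Finset.card_sdiff_of_subset (Finset.filter_subset _ _)
    have h3 : D.card = (ballIn G A x (t + p)).card - (ballIn G A x t).card :=
      Finset.card_sdiff_of_subset hsub
    have h4 : (ballIn G Z x t).card ≤ Z.card := Finset.card_le_card (Finset.filter_subset _ _)
    have h5 : (ballIn G Z x r).card ≤ (ballIn G Z x t).card := by
      refine Finset.card_le_card fun y hy => ?_
      simp only [ballIn, Finset.mem_filter] at hy ⊢
      exact ⟨hy.1, by omega⟩
    rw [htp, ← h3]
    omega
  have hmono : Monotone fun k : ℕ => (ballIn G A x (r + k * p)).card := by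
    intro a b hab
    refine Finset.card_le_card fun y hy => ?_
    simp only [ballIn, Finset.mem_filter] at hy ⊢
    have := Nat.mul_le_mul_right p hab
    exact ⟨hy.1, by omega⟩
  -- The `N` annuli are consecutive, so their sizes telescope to at most the size of the part of `A`
  -- in the outer ball.
  have hsum := Finset.sum_le_sum key
  rw [Finset.sum_range_tsub hmono N] at hsum
  simp only [Finset.sum_const, Finset.card_range, smul_eq_mul] at hsum
  omega

/-- A set of growth below `N ^ n` at scale `n * N * p` is covered by `n` fragmented sets. -/
theorem exists_fragmented_cover [DecidableEq V] {G : SimpleGraph V} (hG : G.Connected) (p N : ℕ) (n : ℕ) :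
    ∀ A : Finset V, (∀ x, (ballIn G A x (n * N * p)).card < N ^ n) →
      ∃ F : ℕ → Set V, (∀ j, Fragmented G p (n * N * p) (F j)) ∧ ∀ v ∈ A, ∃ j < n, v ∈ F j := by
  induction n with
  | zero =>
    intro A hA
    refine ⟨fun _ => ∅, fun _ => ⟨id, by simp, by simp⟩, fun v hv => ?_⟩
    have := hA v
    rw [pow_zero, Nat.lt_one_iff, Finset.card_eq_zero] at this
    have hv' : v ∈ ballIn G A v (0 * N * p) := by simp [ballIn, hv]
    rw [this] at hv'
    simp at hv'
  | succ n ih =>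
    intro A hA
    -- The complement of the separator is the last fragmented set. The separator itself has `N`
    -- times fewer points in balls of the smaller radius, which is exactly the induction hypothesis.
    obtain ⟨Z, -, hfrag, hZ⟩ := exists_separator hG A p N (n * N * p)
    have hR : n * N * p + N * p = (n + 1) * N * p := by ring
    rw [hR] at hfrag hZ
    obtain ⟨F, hF, hcov⟩ := ih Z fun x => by
      have h := (hZ x).trans_lt (hA x)
      rw [pow_succ'] at h
      exact Nat.lt_of_mul_lt_mul_left h
    refine ⟨fun j => if j < n then F j else (A \ Z : Finset V), fun j => ?_, fun v hv => ?_⟩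
    · dsimp only
      split_ifs
      · exact (hF j).mono (by rw [← hR]; omega)
      · exact hfrag
    · by_cases hvZ : v ∈ Z
      · obtain ⟨j, hj, hv'⟩ := hcov v hvZ
        exact ⟨j, by omega, by simpa [hj] using hv'⟩
      · exact ⟨n, by omega, by simp [hv, hvZ]⟩

/-- The `b`-neighbourhood of a set of vertices. -/
def nbhd (G : SimpleGraph V) (b : ℕ) (A : Set V) : Set V := {v | ∃ u ∈ A, G.dist u v ≤ b}

/-- Each point inherits the label of a point of `A` within `b`, which costs `b` in the radius and `2
* b` in the separation. The remaining separation, more than `1`, says that no edge joins two pieces.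
-/
theorem Fragmented.nbhd {G : SimpleGraph V} (hG : G.Connected) {b R : ℕ} {A : Set V}
    (h : Fragmented G (2 * b + 1) R A) : Fragmented G 1 (R + b) (nbhd G b A) := by
  classical
  obtain ⟨f, h1, h2⟩ := h
  choose! g hgA hgd using fun v (hv : v ∈ QCode.nbhd G b A) => hv
  refine ⟨fun v => f (g v), fun v hv => ?_, fun v hv w hw hvw => ?_⟩
  · change G.dist (f (g v)) v ≤ R + b
    have := hG.dist_triangle (u := f (g v)) (v := g v) (w := v)
    have := h1 _ (hgA v hv)
    have := hgd v hv
    omega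
  · have h3 := h2 _ (hgA v hv) _ (hgA w hw) hvw
    have t1 := hG.dist_triangle (u := g v) (v := v) (w := g w)
    have t2 := hG.dist_triangle (u := v) (v := w) (w := g w)
    have t3 : G.dist w (g w) = G.dist (g w) w := SimpleGraph.dist_comm
    have := hgd v hv
    have := hgd w hw
    omega

end Fragmented

/-! ### Covering exponents and growth -/

section Growth

theorem coe_edist_eq_dist {V : Type*} {G : SimpleGraph V} (hG : G.Connected) (u v : V) :
    ((G.edist u v : ℕ∞) : ℝ≥0∞) = (G.dist u v : ℝ≥0∞) := by
  rw [← (hG u v).coe_dist_eq_edist]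
  simp

/-- Graph distances are integers, so balls of radius `1 / 2` are single points and a cover by them
counts vertices. The bound `1 ≤ R` guarantees `1 / 2 < R`. -/
theorem card_ballIn_le {I : Type*} {V : I → Type*} [∀ i, Fintype (V i)]
    {G : ∀ i, SimpleGraph (V i)} (hG : ∀ i, (G i).Connected) {s : ℝ≥0}
    (hs : IsCoveringExponent (fun i u v => (((G i).edist u v : ℕ∞) : ℝ≥0∞)) s) :
    ∃ C : ℝ, 0 < C ∧ ∀ i (x : V i) (R : ℕ), 1 ≤ R →
      ((ballIn (G i) Finset.univ x R).card : ℝ) ≤ C * (2 * R) ^ (s : ℝ) := by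
  obtain ⟨C, hC, h⟩ := hs
  refine ⟨C, hC, fun i x R hR => ?_⟩
  have hR' : (1 : ℝ) ≤ R := by exact_mod_cast hR
  obtain ⟨F, hF, hcov⟩ := h i x (1 / 2) R (by norm_num) (by linarith)
  have hsub : ballIn (G i) Finset.univ x R ⊆ F := by
    intro y hy
    simp only [ballIn, Finset.mem_filter, Finset.mem_univ, true_and] at hy
    obtain ⟨z, hz, hzy⟩ := hcov y (by
      simp only [coe_edist_eq_dist (hG i), ENNReal.ofReal_natCast]
      exact_mod_cast hy)
    simp only [coe_edist_eq_dist (hG i)] at hzy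
    have h0 : (G i).dist z y = 0 := by
      by_contra hne
      have h1 : (1 : ℝ≥0∞) ≤ ((G i).dist z y : ℝ≥0∞) := by
        exact_mod_cast Nat.one_le_iff_ne_zero.2 hne
      have h2 : ENNReal.ofReal (1 / 2) < 1 := by
        rw [← ENNReal.ofReal_one]
        exact (ENNReal.ofReal_lt_ofReal_iff (by norm_num)).2 (by norm_num)
      exact absurd (h1.trans hzy) (not_le.2 h2)
    rwa [← ((hG i).dist_eq_zero_iff).1 h0]
  calc ((ballIn (G i) Finset.univ x R).card : ℝ) ≤ F.card := by
        exact_mod_cast Finset.card_le_card hsub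
    _ ≤ C * (R / (1 / 2)) ^ (s : ℝ) := hF
    _ = C * (2 * R) ^ (s : ℝ) := by congr 2; ring

theorem exists_scale (C : ℝ) (s : ℝ≥0) (n p : ℕ) (hs : (s : ℝ) < n) :
    ∃ N : ℕ, 1 ≤ N ∧ C * (2 * ((n * N * p : ℕ) : ℝ)) ^ (s : ℝ) < (N : ℝ) ^ n := by
  have h1 : Filter.Tendsto (fun N : ℕ => ((N : ℝ)) ^ ((n : ℝ) - s)) Filter.atTop Filter.atTop :=
    (tendsto_rpow_atTop (sub_pos.2 hs)).comp tendsto_natCast_atTop_atTop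
  obtain ⟨N, hN, hN1⟩ := ((h1.eventually_gt_atTop (C * (2 * n * p) ^ (s : ℝ))).and
    (Filter.eventually_ge_atTop 1)).exists
  refine ⟨N, hN1, ?_⟩
  have hNpos : (0 : ℝ) < N := by exact_mod_cast hN1
  have e1 : (2 * ((n * N * p : ℕ) : ℝ)) ^ (s : ℝ) = (2 * n * p) ^ (s : ℝ) * (N : ℝ) ^ (s : ℝ) := by
    rw [← Real.mul_rpow (by positivity) hNpos.le]
    push_cast
    ring_nf
  have e2 : (N : ℝ) ^ n = (N : ℝ) ^ ((n : ℝ) - s) * (N : ℝ) ^ (s : ℝ) := by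
    rw [← Real.rpow_add hNpos, sub_add_cancel, Real.rpow_natCast]
  rw [e1, e2, ← mul_assoc]
  exact mul_lt_mul_of_pos_right hN (Real.rpow_pos_of_pos hNpos _)

/-- Graphs of dimension less than `n` are uniformly covered by `n` fragmented sets. -/
theorem exists_uniform_fragmented_cover {I : Type*} {V : I → Type*} [∀ i, Fintype (V i)]
    [∀ i, DecidableEq (V i)]
    {G : ∀ i, SimpleGraph (V i)} (hG : ∀ i, (G i).Connected) {n : ℕ}
    (hn : assouadDim (fun i u v => (((G i).edist u v : ℕ∞) : ℝ≥0∞)) < n) (p : ℕ) :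
    ∃ R : ℕ, ∀ i, ∃ F : ℕ → Set (V i), (∀ j, Fragmented (G i) p R (F j)) ∧
      ∀ v, ∃ j < n, v ∈ F j := by
  simp only [assouadDim, iInf_lt_iff] at hn
  obtain ⟨s, hs, hsn⟩ := hn
  have hsn' : (s : ℝ) < n := by exact_mod_cast hsn
  obtain ⟨C, hC, hgrow⟩ := card_ballIn_le hG hs
  have hn0 : 1 ≤ n := by
    by_contra h
    have : n = 0 := by omega
    subst this
    have := s.2
    simp only [Nat.cast_zero] at hsn'
    exact absurd hsn' (not_lt.2 this)
  -- The volume at scale `n * N * (p + 1)` grows like `N ^ s` with `s < n`, so it eventually falls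
  -- below `N ^ n`. Using `p + 1` keeps the scale positive when `p = 0`.
  obtain ⟨N, hN1, hN⟩ := exists_scale C s n (p + 1) hsn'
  refine ⟨n * N * (p + 1), fun i => ?_⟩
  obtain ⟨F, hF, hcov⟩ := exists_fragmented_cover (hG i) (p + 1) N n Finset.univ fun x => by
    have h := (hgrow i x (n * N * (p + 1))
      (Nat.mul_pos (Nat.mul_pos hn0 hN1) (Nat.succ_pos p))).trans_lt hN
    exact_mod_cast h
  refine ⟨F, fun j => ?_, fun v => hcov v (Finset.mem_univ v)⟩
  obtain ⟨f, h1, h2⟩ := hF j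
  exact ⟨f, h1, fun u hu v hv huv => (Nat.lt_succ_self p).trans (h2 u hu v hv huv)⟩

theorem exists_ball_bound {I : Type*} {V : I → Type*} [∀ i, Fintype (V i)]
    {G : ∀ i, SimpleGraph (V i)} (hG : ∀ i, (G i).Connected)
    (hn : assouadDim (fun i u v => (((G i).edist u v : ℕ∞) : ℝ≥0∞)) < ⊤) (R : ℕ) :
    ∃ M : ℕ, ∀ i (x : V i), (ballIn (G i) Finset.univ x R).card < M := by
  simp only [assouadDim, iInf_lt_iff] at hn
  obtain ⟨s, hs, -⟩ := hn
  obtain ⟨C, hC, hgrow⟩ := card_ballIn_le hG hs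
  obtain ⟨M, hM⟩ := exists_nat_gt (C * (2 * ((R + 1 : ℕ) : ℝ)) ^ (s : ℝ))
  refine ⟨M, fun i x => ?_⟩
  have h1 : (ballIn (G i) Finset.univ x R).card ≤ (ballIn (G i) Finset.univ x (R + 1)).card := by
    refine Finset.card_le_card fun y hy => ?_
    simp only [ballIn, Finset.mem_filter] at hy ⊢
    exact ⟨hy.1, by omega⟩
  have h2 := (hgrow i x (R + 1) (by omega)).trans_lt hM
  exact h1.trans_lt (by exact_mod_cast h2)

end Growth

/-! ### The dimension of the multi-block graph -/

section MultiBlockDim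

variable {V : Type*} [DecidableEq V] {K : ℕ}

/-- Every edge weighs at least the distance between the projections of its ends; the weight `d + 1`
of a virtual edge is more than enough. -/
theorem dist_le_multiBlockDist {G : SimpleGraph V} (hG : G.Connected)
    (𝒢' : Set (QOp (Fin K × V))) (p q : Fin K × V) :
    (G.dist p.2 q.2 : ℝ≥0∞) ≤ multiBlockDist G 𝒢' p q := by
  refine le_iInf fun w => ?_
  rw [Nat.cast_le]
  induction w with
  | nil => simp
  | @cons a b c hab w ih =>
    have h1 := hG.dist_triangle (u := a.2) (v := b.2) (w := c.2)
    have h2 : G.dist a.2 b.2 ≤ edgeWeight G a b := by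
      unfold edgeWeight
      split_ifs with h
      · rcases hab with hab | hab
        · exact (SimpleGraph.dist_eq_one_iff_adj.2 hab.2).le
        · exact absurd h hab.1
      · omega
    have h3 : walkWeight (edgeWeight G) (SimpleGraph.Walk.cons hab w) =
        edgeWeight G a b + walkWeight (edgeWeight G) w := by
      simp [walkWeight]
    omega

theorem multiBlockDist_le_dist {G : SimpleGraph V} (hG : G.Connected)
    (𝒢' : Set (QOp (Fin K × V))) (j : Fin K) (x y : V) :
    multiBlockDist G 𝒢' (j, x) (j, y) ≤ (G.dist x y : ℝ≥0∞) := by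
  have key : ∀ {x y : V} (w : G.Walk x y), ∃ w' : (multiBlockGraph G 𝒢').Walk (j, x) (j, y),
      walkWeight (edgeWeight G) w' = w.length := by
    intro x y w
    induction w with
    | nil => exact ⟨SimpleGraph.Walk.nil, by simp [walkWeight]⟩
    | @cons a b c hab w ih =>
      obtain ⟨w', hw'⟩ := ih
      have hadj : (multiBlockGraph G 𝒢').Adj (j, a) (j, b) := Or.inl ⟨rfl, hab⟩
      refine ⟨SimpleGraph.Walk.cons hadj w', ?_⟩
      have h1 : edgeWeight G (j, a) (j, b) = 1 := by simp [edgeWeight]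
      simp only [walkWeight] at hw'
      simp [walkWeight, hw', h1, add_comm]
  obtain ⟨w, hw⟩ := hG.exists_walk_length_eq_dist x y
  obtain ⟨w', hw'⟩ := key w
  refine (iInf_le _ w').trans ?_
  rw [hw', hw]

end MultiBlockDim

theorem multiBlockIntrinsicDim_eq {I : Type*} {V : I → Type*} [∀ i, Fintype (V i)]
    [∀ i, DecidableEq (V i)] (S : ∀ i, Set (QOp (V i)))
    (hconn : ∀ i, (connectivityGraph (S i)).Connected) {K : ℕ} (hK : 1 ≤ K)
    (𝒢' : ∀ i, Set (QOp (Fin K × V i))) :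
    multiBlockIntrinsicDim S 𝒢' = intrinsicDim S := by
  have key : ∀ s : ℝ≥0,
      IsCoveringExponent (fun i => multiBlockDist (connectivityGraph (S i)) (𝒢' i)) s ↔
      IsCoveringExponent
        (fun i u v => (((connectivityGraph (S i)).edist u v : ℕ∞) : ℝ≥0∞)) s := by
    intro s
    simp only [IsCoveringExponent, coe_edist_eq_dist (hconn _)]
    constructor
    · rintro ⟨C, hC, h⟩
      refine ⟨C, hC, fun i x r R hr hrR => ?_⟩
      obtain ⟨F, hF, hcov⟩ := h i (⟨0, hK⟩, x) r R hr hrR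
      refine ⟨F.image Prod.snd, le_trans (by exact_mod_cast Finset.card_image_le) hF,
        fun y hy => ?_⟩
      obtain ⟨z, hz, hzy⟩ := hcov (⟨0, hK⟩, y)
        ((multiBlockDist_le_dist (hconn i) (𝒢' i) _ x y).trans hy)
      exact ⟨z.2, Finset.mem_image_of_mem _ hz,
        (dist_le_multiBlockDist (hconn i) (𝒢' i) z _).trans hzy⟩
    · rintro ⟨C, hC, h⟩
      have hK' : (0 : ℝ) < K := by exact_mod_cast hK
      -- One copy of each centre is placed in every block, whence the factor `K`.
      refine ⟨K * C, by positivity, fun i x r R hr hrR => ?_⟩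
      obtain ⟨F, hF, hcov⟩ := h i x.2 r R hr hrR
      refine ⟨Finset.univ ×ˢ F, ?_, fun y hy => ?_⟩
      · rw [Finset.card_product, Finset.card_univ, Fintype.card_fin, mul_assoc]
        push_cast
        exact mul_le_mul_of_nonneg_left hF hK'.le
      · obtain ⟨z, hz, hzy⟩ := hcov y.2
          ((dist_le_multiBlockDist (hconn i) (𝒢' i) x y).trans hy)
        exact ⟨(y.1, z), by simp [hz],
          (multiBlockDist_le_dist (hconn i) (𝒢' i) y.1 z y.2).trans hzy⟩
  simp only [multiBlockIntrinsicDim, intrinsicDim, assouadDim, key]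

/-! ### Tensor products of single-qubit operators -/

section Tensor

variable {Q : Type*} [Fintype Q]

/-- The tensor product of single-qubit operators. -/
def tensorOp (M : Q → Matrix (Fin 2) (Fin 2) ℂ) : QOp Q :=
  Matrix.of fun a b => ∏ q, M q (a q) (b q)

theorem tensorOp_mul [DecidableEq Q] (M N : Q → Matrix (Fin 2) (Fin 2) ℂ) :
    tensorOp M * tensorOp N = tensorOp (fun q => M q * N q) := by
  ext a b
  simp only [Matrix.mul_apply, tensorOp, Matrix.of_apply, ← Finset.prod_mul_distrib]
  rw [Finset.prod_univ_sum]
  simp [Fintype.piFinset_univ]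

theorem tensorOp_smul (c : Q → ℂ) (M : Q → Matrix (Fin 2) (Fin 2) ℂ) :
    tensorOp (fun q => c q • M q) = (∏ q, c q) • tensorOp M := by
  ext a b
  simp [tensorOp, Finset.prod_mul_distrib]

theorem tensorOp_one [DecidableEq Q] :
    tensorOp (fun _ : Q => (1 : Matrix (Fin 2) (Fin 2) ℂ)) = 1 := by
  ext a b
  simp only [tensorOp, Matrix.of_apply, Matrix.one_apply]
  by_cases h : a = b
  · simp [h]
  · rw [if_neg h]
    obtain ⟨q, hq⟩ := Function.ne_iff.1 h
    exact Finset.prod_eq_zero (Finset.mem_univ q) (if_neg hq)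

theorem tensorOp_conjTranspose (M : Q → Matrix (Fin 2) (Fin 2) ℂ) :
    (tensorOp M).conjTranspose = tensorOp (fun q => (M q).conjTranspose) := by
  ext a b
  simp [tensorOp, Matrix.conjTranspose_apply]

theorem tensorOp_single_apply [DecidableEq Q] (q : Q) (P : Matrix (Fin 2) (Fin 2) ℂ)
    (a b : Q → Fin 2) :
    tensorOp (fun q' => if q' = q then P else 1) a b =
      if ∀ q', q' ≠ q → a q' = b q' then P (a q) (b q) else 0 := by
  simp only [tensorOp, Matrix.of_apply]
  split_ifs with h
  · rw [Finset.prod_eq_single q]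
    · simp
    · intro q' _ hq'
      rw [if_neg hq', h q' hq', Matrix.one_apply_eq]
    · simp
  · push Not at h
    obtain ⟨q', hq', hne⟩ := h
    refine Finset.prod_eq_zero (Finset.mem_univ q') ?_
    simp [hq', hne]

theorem mul_tensorOp_single [DecidableEq Q] (M : QOp Q) (q : Q) (P : Matrix (Fin 2) (Fin 2) ℂ)
    (a b : Q → Fin 2) :
    (M * tensorOp (fun q' => if q' = q then P else 1)) a b =
      ∑ t, M a (Function.update b q t) * P t (b q) := by
  rw [Matrix.mul_apply]
  symm
  refine Fintype.sum_of_injective (fun t => Function.update b q t)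
    (Function.update_injective b q) _ _ ?_ ?_
  · intro c hc
    rw [tensorOp_single_apply, if_neg, mul_zero]
    intro h
    refine hc ⟨c q, ?_⟩
    ext q'
    by_cases hq' : q' = q
    · subst hq'; simp
    · simp [hq', h q' hq']
  · intro t
    rw [tensorOp_single_apply, if_pos]
    · simp
    · intro q' hq'; simp [hq']

theorem tensorOp_single_mul [DecidableEq Q] (M : QOp Q) (q : Q) (P : Matrix (Fin 2) (Fin 2) ℂ)
    (a b : Q → Fin 2) :
    (tensorOp (fun q' => if q' = q then P else 1) * M) a b =
      ∑ t, P (a q) t * M (Function.update a q t) b := by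
  rw [Matrix.mul_apply]
  symm
  refine Fintype.sum_of_injective (fun t => Function.update a q t)
    (Function.update_injective a q) _ _ ?_ ?_
  · intro c hc
    rw [tensorOp_single_apply, if_neg, zero_mul]
    intro h
    refine hc ⟨c q, ?_⟩
    ext q'
    by_cases hq' : q' = q
    · subst hq'; simp
    · simp [hq', h q' hq']
  · intro t
    rw [tensorOp_single_apply, if_pos]
    · simp
    · intro q' hq'; simp [hq']

end Tensor

/-! ### Pauli strings labelled by binary vectors -/

section Pauli

/-- Labels of single-qubit Pauli matrices. -/
abbrev PauliLabel := ZMod 2 × ZMod 2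

/-- The index of the Pauli matrix with label `(x, z)`. -/
def pauliIndex (u : PauliLabel) : Fin 4 :=
  if u.1 = 0 then (if u.2 = 0 then 0 else 3) else (if u.2 = 0 then 1 else 2)

/-- The single-qubit Pauli matrix with label `(x, z)`. -/
noncomputable def pauli1 (u : PauliLabel) : Matrix (Fin 2) (Fin 2) ℂ := pauliMatrix (pauliIndex u)

/-- The symplectic form on labels. -/
def symp1 (u v : PauliLabel) : ZMod 2 := u.1 * v.2 + u.2 * v.1

/-- The sign `(-1) ^ t`. -/
noncomputable def sgn (t : ZMod 2) : ℂ := if t = 0 then 1 else -1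

theorem zmod2_cases (t : ZMod 2) : t = 0 ∨ t = 1 := by
  revert t; decide

theorem sgn_zero : sgn 0 = 1 := by simp [sgn]

theorem sgn_one : sgn 1 = -1 := by simp [sgn]

theorem sgn_add (s t : ZMod 2) : sgn (s + t) = sgn s * sgn t := by
  have h : (1 : ZMod 2) + 1 = 0 := by decide
  rcases zmod2_cases s with rfl | rfl <;> rcases zmod2_cases t with rfl | rfl <;>
    simp [sgn_zero, sgn_one, h]

theorem sgn_sum {ι : Type*} (s : Finset ι) (f : ι → ZMod 2) :
    sgn (∑ i ∈ s, f i) = ∏ i ∈ s, sgn (f i) := by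
  classical
  induction s using Finset.induction_on with
  | empty => simp [sgn_zero]
  | insert a s ha ih => rw [Finset.sum_insert ha, Finset.prod_insert ha, sgn_add, ih]

theorem sgn_eq_one_iff {t : ZMod 2} : sgn t = 1 ↔ t = 0 := by
  rcases zmod2_cases t with rfl | rfl
  · simp [sgn_zero]
  · simp only [sgn_one, one_ne_zero, iff_false]; norm_num

theorem norm_sgn (t : ZMod 2) : ‖sgn t‖ = 1 := by
  rcases zmod2_cases t with rfl | rfl <;> simp [sgn_zero, sgn_one]

theorem pauliIndex_surjective : Function.Surjective pauliIndex := by decide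

theorem pauliIndex_zero : pauliIndex 0 = 0 := by decide

theorem pauli1_zero : pauli1 0 = 1 := by
  rw [pauli1, pauliIndex_zero]; rfl

theorem pauli1_conjTranspose (u : PauliLabel) : (pauli1 u).conjTranspose = pauli1 u := by
  unfold pauli1
  generalize pauliIndex u = k
  fin_cases k <;> ext i j <;> fin_cases i <;> fin_cases j <;>
    simp [pauliMatrix, Matrix.conjTranspose_apply]

theorem pauli1_mul_self (u : PauliLabel) : pauli1 u * pauli1 u = 1 := by
  unfold pauli1
  generalize pauliIndex u = k
  fin_cases k <;> ext i j <;> fin_cases i <;> fin_cases j <;>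
    simp [pauliMatrix, Matrix.mul_apply]

theorem pauli1_comm (u v : PauliLabel) :
    pauli1 u * pauli1 v = sgn (symp1 u v) • (pauli1 v * pauli1 u) := by
  obtain ⟨a, b⟩ := u
  obtain ⟨c, d⟩ := v
  have h : (1 : ZMod 2) + 1 = 0 := by decide
  rcases zmod2_cases a with rfl | rfl <;> rcases zmod2_cases b with rfl | rfl <;>
    rcases zmod2_cases c with rfl | rfl <;> rcases zmod2_cases d with rfl | rfl <;>
    ext i j <;> fin_cases i <;> fin_cases j <;>
    simp [pauli1, pauliIndex, symp1, sgn_zero, sgn_one, pauliMatrix, Matrix.mul_apply, h]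

theorem one_mem_pauliPhases : (1 : ℂ) ∈ pauliPhases := by simp [pauliPhases]

theorem mul_mem_pauliPhases {c d : ℂ} (hc : c ∈ pauliPhases) (hd : d ∈ pauliPhases) :
    c * d ∈ pauliPhases := by
  simp only [pauliPhases, Set.mem_insert_iff, Set.mem_singleton_iff] at *
  rcases hc with rfl | rfl | rfl | rfl <;> rcases hd with rfl | rfl | rfl | rfl <;> simp

theorem pauli1_mul (u v : PauliLabel) :
    ∃ c ∈ pauliPhases, pauli1 u * pauli1 v = c • pauli1 (u + v) := by
  obtain ⟨a, b⟩ := u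
  obtain ⟨c, d⟩ := v
  have h : (1 : ZMod 2) + 1 = 0 := by decide
  have key : ∀ M : Matrix (Fin 2) (Fin 2) ℂ, ∀ N : Matrix (Fin 2) (Fin 2) ℂ,
      (M = N ∨ M = -N ∨ M = Complex.I • N ∨ M = -Complex.I • N) →
      ∃ c ∈ pauliPhases, M = c • N := by
    rintro M N (h | h | h | h)
    · exact ⟨1, by simp [pauliPhases], by simp [h]⟩
    · exact ⟨-1, by simp [pauliPhases], by simp [h]⟩
    · exact ⟨Complex.I, by simp [pauliPhases], by simp [h]⟩
    · exact ⟨-Complex.I, by simp [pauliPhases], by simp [h]⟩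
  apply key
  rcases zmod2_cases a with rfl | rfl <;> rcases zmod2_cases b with rfl | rfl <;>
    rcases zmod2_cases c with rfl | rfl <;> rcases zmod2_cases d with rfl | rfl <;>
    simp [pauli1, pauliIndex, pauliMatrix, h, ← Matrix.ext_iff, Fin.forall_fin_two]

variable {Q : Type*} [Fintype Q]

/-- The Pauli string with the given labels. -/
noncomputable def pauliW (v : Q → PauliLabel) : QOp Q := tensorOp fun q => pauli1 (v q)

/-- The symplectic form on label vectors. -/
def symp (v w : Q → PauliLabel) : ZMod 2 := ∑ q, symp1 (v q) (w q)

theorem mem_pauliGroup_iff {P : QOp Q} :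
    P ∈ pauliGroup Q ↔ ∃ c ∈ pauliPhases, ∃ v : Q → PauliLabel, P = c • pauliW v := by
  constructor
  · rintro ⟨c, hc, σ, rfl⟩
    choose g hg using pauliIndex_surjective
    refine ⟨c, hc, fun q => g (σ q), ?_⟩
    simp only [pauliW, pauli1, hg]
    rfl
  · rintro ⟨c, hc, v, rfl⟩
    exact ⟨c, hc, fun q => pauliIndex (v q), rfl⟩

theorem pauliW_mem_pauliGroup (v : Q → PauliLabel) : pauliW v ∈ pauliGroup Q :=
  mem_pauliGroup_iff.2 ⟨1, one_mem_pauliPhases, v, by simp⟩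

theorem pauliW_conjTranspose (v : Q → PauliLabel) : (pauliW v).conjTranspose = pauliW v := by
  simp [pauliW, tensorOp_conjTranspose, pauli1_conjTranspose]

theorem pauliGroup_conjTranspose {P : QOp Q} (hP : P ∈ pauliGroup Q) :
    P.conjTranspose ∈ pauliGroup Q := by
  obtain ⟨c, hc, v, rfl⟩ := mem_pauliGroup_iff.1 hP
  refine mem_pauliGroup_iff.2 ⟨star c, ?_, v, ?_⟩
  · simp only [pauliPhases, Set.mem_insert_iff, Set.mem_singleton_iff] at hc ⊢
    rcases hc with rfl | rfl | rfl | rfl <;> simp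
  · rw [Matrix.conjTranspose_smul, pauliW_conjTranspose]

variable [DecidableEq Q]

theorem pauliW_zero : pauliW (0 : Q → PauliLabel) = 1 := by
  simp [pauliW, pauli1_zero, tensorOp_one]

theorem pauliW_mul_self (v : Q → PauliLabel) : pauliW v * pauliW v = 1 := by
  simp [pauliW, tensorOp_mul, pauli1_mul_self, tensorOp_one]

theorem pauliW_comm (v w : Q → PauliLabel) :
    pauliW v * pauliW w = sgn (symp v w) • (pauliW w * pauliW v) := by
  simp only [pauliW, tensorOp_mul, symp, sgn_sum]
  rw [← tensorOp_smul]
  simp only [← pauli1_comm]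

theorem pauliW_mul (v w : Q → PauliLabel) :
    ∃ c ∈ pauliPhases, pauliW v * pauliW w = c • pauliW (v + w) := by
  choose c hc h using fun q => pauli1_mul (v q) (w q)
  refine ⟨∏ q, c q, ?_, ?_⟩
  · exact Finset.prod_induction c (· ∈ pauliPhases) (fun _ _ => mul_mem_pauliPhases)
      one_mem_pauliPhases fun q _ => hc q
  · simp only [pauliW, tensorOp_mul, h, tensorOp_smul]
    rfl

theorem pauliW_ne_zero (v : Q → PauliLabel) : pauliW v ≠ 0 := by
  intro h
  have := pauliW_mul_self v
  rw [h, zero_mul] at this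
  exact zero_ne_one this

theorem pauliW_commute_iff {v w : Q → PauliLabel} :
    Commute (pauliW v) (pauliW w) ↔ symp v w = 0 := by
  unfold Commute SemiconjBy
  constructor
  · intro h
    rw [pauliW_comm] at h
    have h2 : (sgn (symp v w) - 1) • (pauliW w * pauliW v) = 0 := by
      rw [sub_smul, one_smul, h, sub_self]
    rcases smul_eq_zero.1 h2 with h3 | h3
    · exact sgn_eq_one_iff.1 (sub_eq_zero.1 h3)
    · exfalso
      apply pauliW_ne_zero v
      have := congrArg (pauliW w * ·) h3
      simpa [← mul_assoc, pauliW_mul_self] using this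
  · intro h
    rw [pauliW_comm, h, sgn_zero, one_smul]

theorem norm_of_mem_pauliPhases {c : ℂ} (hc : c ∈ pauliPhases) : ‖c‖ = 1 := by
  simp only [pauliPhases, Set.mem_insert_iff, Set.mem_singleton_iff] at hc
  rcases hc with rfl | rfl | rfl | rfl <;> simp

theorem pauliGroup_unitary {P : QOp Q} (hP : P ∈ pauliGroup Q) :
    P ∈ Matrix.unitaryGroup (Q → Fin 2) ℂ := by
  obtain ⟨c, hc, v, rfl⟩ := mem_pauliGroup_iff.1 hP
  rw [Matrix.mem_unitaryGroup_iff, Matrix.star_eq_conjTranspose, Matrix.conjTranspose_smul,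
    pauliW_conjTranspose, smul_mul_smul_comm, pauliW_mul_self, ← starRingEnd_apply,
    Complex.mul_conj, Complex.normSq_eq_norm_sq, norm_of_mem_pauliPhases hc]
  simp

end Pauli

/-! ### Supports -/

section Support

variable {Q : Type*} [DecidableEq Q]

theorem pauliW_single [Fintype Q] (q : Q) (u : PauliLabel) :
    pauliW (Pi.single q u) = tensorOp (fun q' => if q' = q then pauli1 u else 1) := by
  unfold pauliW
  congr 1
  ext1 q'
  by_cases h : q' = q
  · subst h; simp
  · simp [h, pauli1_zero]

theorem symp1_eq_zero {u : PauliLabel} (h : ∀ w, symp1 u w = 0) : u = 0 := by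
  revert u; decide

/-- This turns the entrywise definition into membership in a commutant, so that closure under
products and adjoints becomes formal. Commuting with `Z` kills the entries off the diagonal at `q`;
commuting with `X` equates the two diagonal blocks. -/
theorem actsTriviallyAt_iff [Fintype Q] (M : QOp Q) (q : Q) :
    ActsTriviallyAt M q ↔ ∀ u, Commute M (pauliW (Pi.single q u)) := by
  constructor
  · intro h u
    ext a b
    rw [pauliW_single, mul_tensorOp_single, tensorOp_single_mul]
    by_cases hab : a q = b q
    · have e : ∀ t, t ≠ a q → M a (Function.update b q t) = 0 ∧ M (Function.update a q t) b = 0 :=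
        fun t ht => ⟨(h _ _).1 (by simpa using ht.symm), (h _ _).1 (by simpa [← hab] using ht)⟩
      rw [Finset.sum_eq_single (a q), Finset.sum_eq_single (a q)]
      · rw [Function.update_eq_self, hab, Function.update_eq_self, mul_comm]
      · intro t _ ht; rw [(e t ht).2, mul_zero]
      · simp
      · intro t _ ht; rw [(e t ht).1, zero_mul]
      · simp
    · rw [Finset.sum_eq_single (a q), Finset.sum_eq_single (b q)]
      · have := (h a (Function.update b q (a q))).2 (by simp) (b q)
        rw [Function.update_idem, Function.update_eq_self] at this
        rw [← this, mul_comm]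
      · intro t _ ht
        rw [(h _ _).1 (by simpa using ht), mul_zero]
      · simp
      · intro t _ ht
        rw [(h _ _).1 (by simpa using ht.symm), zero_mul]
      · simp
  · intro h
    have hZ := h (0, 1)
    have hX := h (1, 0)
    have eZ : pauli1 (0, 1) = !![1, 0; 0, -1] := rfl
    have eX : pauli1 (1, 0) = !![0, 1; 1, 0] := rfl
    rw [pauliW_single, eZ] at hZ
    rw [pauliW_single, eX] at hX
    have hZ' := fun a b => congrFun (congrFun hZ a) b
    have hX' := fun a b => congrFun (congrFun hX a) b
    simp only [mul_tensorOp_single, tensorOp_single_mul, Fin.sum_univ_two] at hZ' hX'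
    have fin2 : ∀ t : Fin 2, t = 0 ∨ t = 1 := by decide
    intro a b
    constructor
    · intro hab
      have hz := hZ' a b
      rcases fin2 (a q) with ha | ha <;> rcases fin2 (b q) with hb | hb
      · exact absurd (ha.trans hb.symm) hab
      · have e1 : Function.update b q 1 = b := by rw [← hb, Function.update_eq_self]
        have e2 : Function.update a q 0 = a := by rw [← ha, Function.update_eq_self]
        simp [ha, hb, e1, e2] at hz
        linear_combination (-1/2 : ℂ) * hz
      · have e1 : Function.update b q 0 = b := by rw [← hb, Function.update_eq_self]
        have e2 : Function.update a q 1 = a := by rw [← ha, Function.update_eq_self]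
        simp [ha, hb, e1, e2] at hz
        linear_combination (1/2 : ℂ) * hz
      · exact absurd (ha.trans hb.symm) hab
    · intro hab t
      have key : ∀ s t : Fin 2, s ≠ t →
          M (Function.update a q s) (Function.update b q s) =
            M (Function.update a q t) (Function.update b q t) := by
        intro s t hst
        have hx := hX' (Function.update a q s) (Function.update b q t)
        rcases fin2 s with rfl | rfl <;> rcases fin2 t with rfl | rfl
        · exact absurd rfl hst
        · simpa using hx
        · simpa using hx
        · exact absurd rfl hst
      by_cases ht : t = a q
      · rw [ht, Function.update_eq_self, hab, Function.update_eq_self]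
      · have := key t (a q) ht
        rw [this, Function.update_eq_self, hab, Function.update_eq_self]

/-- `M` is supported on the set `A` of qubits. -/
def SupportedOn (M : QOp Q) (A : Set Q) : Prop := ∀ q, q ∉ A → ActsTriviallyAt M q

theorem supportedOn_support (M : QOp Q) : SupportedOn M (support M) :=
  fun _ hq => not_not.1 hq

theorem SupportedOn.mono {M : QOp Q} {A B : Set Q} (h : SupportedOn M A) (hAB : A ⊆ B) :
    SupportedOn M B := fun q hq => h q fun hA => hq (hAB hA)

theorem SupportedOn.support_subset {M : QOp Q} {A : Set Q} (h : SupportedOn M A) :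
    support M ⊆ A := fun q hq => by
  by_contra hA
  exact hq (h q hA)

theorem SupportedOn.apply_eq_zero {M : QOp Q} {A : Set Q} (h : SupportedOn M A)
    {a b : Q → Fin 2} {q : Q} (hq : q ∉ A) (hab : a q ≠ b q) : M a b = 0 :=
  (h q hq a b).1 hab

variable [Fintype Q]

theorem SupportedOn.mul {M N : QOp Q} {A : Set Q} (hM : SupportedOn M A) (hN : SupportedOn N A) :
    SupportedOn (M * N) A := fun q hq => (actsTriviallyAt_iff _ _).2 fun u =>
  ((actsTriviallyAt_iff _ _).1 (hM q hq) u).mul_left ((actsTriviallyAt_iff _ _).1 (hN q hq) u)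

theorem SupportedOn.conjTranspose {M : QOp Q} {A : Set Q} (hM : SupportedOn M A) :
    SupportedOn M.conjTranspose A := fun q hq => (actsTriviallyAt_iff _ _).2 fun u => by
  have h := ((actsTriviallyAt_iff _ _).1 (hM q hq) u).star_star
  rwa [Matrix.star_eq_conjTranspose, Matrix.star_eq_conjTranspose, pauliW_conjTranspose] at h

theorem symp_single (v : Q → PauliLabel) (q : Q) (u : PauliLabel) :
    symp v (Pi.single q u) = symp1 (v q) u := by
  unfold symp
  rw [Finset.sum_eq_single q]
  · simp
  · intro q' _ hq'; simp [hq', symp1]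
  · simp

theorem supportedOn_pauliW_iff {c : ℂ} (hc : c ≠ 0) {v : Q → PauliLabel} {A : Set Q} :
    SupportedOn (c • pauliW v) A ↔ ∀ q, q ∉ A → v q = 0 := by
  refine forall₂_congr fun q _ => ?_
  rw [actsTriviallyAt_iff]
  have : ∀ u, Commute (c • pauliW v) (pauliW (Pi.single q u)) ↔ symp1 (v q) u = 0 := by
    intro u
    rw [Commute.smul_left_iff₀ hc, pauliW_commute_iff, symp_single]
  simp only [this]
  exact ⟨symp1_eq_zero, fun h u => by simp [h, symp1]⟩

theorem support_pauliW {c : ℂ} (hc : c ≠ 0) (v : Q → PauliLabel) :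
    support (c • pauliW v) = {q | v q ≠ 0} := by
  apply subset_antisymm
  · exact ((supportedOn_pauliW_iff hc).2 fun q hq => by simpa using hq).support_subset
  · intro q hq hcon
    refine hq ((supportedOn_pauliW_iff hc (A := {q}ᶜ)).1 ?_ q (by simp))
    intro q' hq'
    simp only [Set.mem_compl_iff, Set.mem_singleton_iff, not_not] at hq'
    rwa [hq']

/-- The entries of an operator supported on `A` are unchanged by a simultaneous modification of
both indices off `A`. -/
theorem SupportedOn.apply_congr {M : QOp Q} {A : Set Q} (h : SupportedOn M A)
    {a b a' b' : Q → Fin 2} (ha : ∀ q ∈ A, a q = a' q) (hb : ∀ q ∈ A, b q = b' q)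
    (hab : ∀ q, q ∉ A → a q = b q) (hab' : ∀ q, q ∉ A → a' q = b' q) : M a b = M a' b' := by
  classical
  have key : ∀ s : Finset Q, (∀ q ∈ s, q ∉ A) → M (s.piecewise a' a) (s.piecewise b' b) = M a b := by
    intro s
    induction s using Finset.induction_on with
    | empty => intro _; simp
    | insert q s hqs ih =>
      intro hs
      have hq := hs q (by simp)
      rw [Finset.piecewise_insert, Finset.piecewise_insert, hab' q hq,
        (h q hq _ _).2 (by simp [hqs, hab q hq]), ih fun q hq => hs q (by simp [hq])]
  have h1 := key {q | q ∉ A} (by simp)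
  have e1 : ({q | q ∉ A} : Finset Q).piecewise a' a = a' := by
    ext q
    by_cases hq : q ∈ A <;> simp [Finset.piecewise, hq, ha]
  have e2 : ({q | q ∉ A} : Finset Q).piecewise b' b = b' := by
    ext q
    by_cases hq : q ∈ A <;> simp [Finset.piecewise, hq, hb]
  rw [← h1, e1, e2]

theorem SupportedOn.commute {M N : QOp Q} {A B : Set Q} (hM : SupportedOn M A)
    (hN : SupportedOn N B) (hAB : Disjoint A B) : Commute M N := by
  classical
  have hBA : ∀ q ∈ B, q ∉ A := fun q hB hA => Set.disjoint_left.1 hAB hA hB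
  replace hN : SupportedOn N Aᶜ := hN.mono hBA
  ext a b
  rw [Matrix.mul_apply, Matrix.mul_apply]
  -- Only one intermediate index survives in each matrix product: an operator on `A` cannot change
  -- values off `A`, and one off `A` cannot change values on `A`. These are `c` for `M * N` and `d`
  -- for `N * M`.
  set c : Q → Fin 2 := fun q => if q ∈ A then b q else a q with hc
  set d : Q → Fin 2 := fun q => if q ∈ A then a q else b q with hd
  rw [Finset.sum_eq_single c, Finset.sum_eq_single d, mul_comm]
  · congr 1
    · apply hN.apply_congr <;> intro q hq <;>
        simp only [Set.mem_compl_iff, not_not] at hq <;> simp [hc, hd, hq]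
    · apply hM.apply_congr <;> intro q hq <;> simp [hc, hd, hq]
  · intro e _ he
    obtain ⟨q, hq⟩ := Function.ne_iff.1 he
    by_cases hqA : q ∈ A
    · rw [hN.apply_eq_zero (q := q) (by simpa using hqA) (by simpa [hd, hqA] using hq.symm),
        zero_mul]
    · rw [hM.apply_eq_zero (q := q) hqA (by simpa [hd, hqA] using hq), mul_zero]
  · simp
  · intro e _ he
    obtain ⟨q, hq⟩ := Function.ne_iff.1 he
    by_cases hqA : q ∈ A
    · rw [hN.apply_eq_zero (q := q) (by simpa using hqA) (by simpa [hc, hqA] using hq),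
        mul_zero]
    · rw [hM.apply_eq_zero (q := q) hqA (by simpa [hc, hqA] using hq.symm), zero_mul]
  · simp

/-- Pauli operators act irreducibly. -/
theorem eq_smul_one_of_commute {M : QOp Q}
    (h : ∀ q u, Commute M (pauliW (Pi.single q u))) : ∃ c : ℂ, M = c • (1 : QOp Q) := by
  have hM : SupportedOn M ∅ := fun q _ => (actsTriviallyAt_iff M q).2 (h q)
  refine ⟨M 0 0, ?_⟩
  ext a b
  rw [Matrix.smul_apply, Matrix.one_apply]
  split_ifs with hab
  · subst hab
    rw [smul_eq_mul, mul_one]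
    apply hM.apply_congr <;> simp
  · obtain ⟨q, hq⟩ := Function.ne_iff.1 hab
    rw [smul_zero]
    exact hM.apply_eq_zero (Set.notMem_empty q) hq

end Support

/-! ### Block operators -/

section BlockOp

variable {V : Type*} [Fintype V] {K : ℕ}

theorem blockOp_one (j : Fin K) : blockOp j (1 : QOp V) = 1 := by
  ext a b
  simp only [blockOp, Matrix.of_apply, Matrix.one_apply]
  by_cases hab : a = b
  · simp [hab]
  · rw [if_neg hab]
    split_ifs with h1 h2
    · refine absurd (funext fun p => ?_) hab
      by_cases hp : p.1 = j
      · have := congrFun h2 p.2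
        rw [← hp] at this
        exact this
      · exact h1 p hp
    · rfl
    · rfl

theorem blockOp_mul [DecidableEq V] (j : Fin K) (M N : QOp V) :
    blockOp j (M * N) = blockOp j M * blockOp j N := by
  classical
  ext a b
  rw [Matrix.mul_apply]
  simp only [blockOp, Matrix.of_apply]
  by_cases hab : ∀ q : Fin K × V, q.1 ≠ j → a q = b q
  · rw [if_pos hab, Matrix.mul_apply]
    refine Fintype.sum_of_injective
      (fun c : V → Fin 2 => fun p : Fin K × V => if p.1 = j then c p.2 else b p) ?_ _ _ ?_ ?_
    · intro c c' h
      ext1 q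
      simpa using congrFun h (j, q)
    · intro c hc
      rw [if_neg (c := ∀ q : Fin K × V, q.1 ≠ j → c q = b q), mul_zero]
      intro h
      refine hc ⟨fun q => c (j, q), ?_⟩
      ext1 p
      by_cases hp : p.1 = j
      · obtain ⟨i, q⟩ := p
        simp only at hp
        subst hp
        simp
      · simp [hp, h p hp]
    · intro c
      rw [if_pos, if_pos]
      · simp
      · intro q hq; simp [hq]
      · intro q hq; simp [hq, hab q hq]
  · rw [if_neg hab]
    symm
    refine Finset.sum_eq_zero fun c _ => ?_
    by_cases h1 : ∀ q : Fin K × V, q.1 ≠ j → a q = c q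
    · rw [if_neg (c := ∀ q : Fin K × V, q.1 ≠ j → c q = b q), mul_zero]
      exact fun h2 => hab fun q hq => (h1 q hq).trans (h2 q hq)
    · rw [if_neg h1, zero_mul]

theorem blockOp_conjTranspose (j : Fin K) (M : QOp V) :
    (blockOp j M).conjTranspose = blockOp j M.conjTranspose := by
  ext a b
  have : (∀ q : Fin K × V, q.1 ≠ j → b q = a q) ↔ ∀ q : Fin K × V, q.1 ≠ j → a q = b q :=
    forall₂_congr fun _ _ => eq_comm
  simp only [Matrix.conjTranspose_apply, blockOp, Matrix.of_apply, this]
  split_ifs <;> simp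

theorem blockOp_smul (j : Fin K) (c : ℂ) (M : QOp V) : blockOp j (c • M) = c • blockOp j M := by
  ext a b
  simp only [Matrix.smul_apply, blockOp, Matrix.of_apply]
  split_ifs <;> simp

theorem blockOp_unitary [DecidableEq V] (j : Fin K) {M : QOp V} (hM : M ∈ Matrix.unitaryGroup (V → Fin 2) ℂ) :
    blockOp j M ∈ Matrix.unitaryGroup (Fin K × V → Fin 2) ℂ := by
  rw [Matrix.mem_unitaryGroup_iff, Matrix.star_eq_conjTranspose] at hM ⊢
  rw [blockOp_conjTranspose, ← blockOp_mul, hM, blockOp_one]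

theorem support_blockOp_subset [DecidableEq V] (j : Fin K) (M : QOp V) :
    support (blockOp j M) ⊆ {p | p.1 = j ∧ p.2 ∈ support M} := by
  rintro ⟨i, v⟩ hp
  by_contra hcon
  refine hp fun a b => ⟨fun hab => ?_, fun hab t => ?_⟩
  · simp only [blockOp, Matrix.of_apply]
    split_ifs with h
    · by_cases hij : i = j
      · subst hij
        have hv : ActsTriviallyAt M v := not_not.1 fun hv => hcon ⟨rfl, hv⟩
        exact (hv _ _).1 hab
      · exact absurd (h (i, v) hij) hab
    · rfl
  · have hiff : (∀ q : Fin K × V, q.1 ≠ j →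
        Function.update a (i, v) t q = Function.update b (i, v) t q) ↔
        ∀ q : Fin K × V, q.1 ≠ j → a q = b q := by
      refine forall₂_congr fun q _ => ?_
      by_cases hq : q = (i, v)
      · subst hq; simp [hab]
      · simp [hq]
    simp only [blockOp, Matrix.of_apply, hiff]
    split_ifs with h
    · by_cases hij : i = j
      · subst hij
        have hv : ActsTriviallyAt M v := not_not.1 fun hv => hcon ⟨rfl, hv⟩
        have e : ∀ c : Fin K × V → Fin 2, (fun w => Function.update c (i, v) t (i, w)) =
            Function.update (fun w => c (i, w)) v t := by
          intro c
          ext1 w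
          by_cases hw : w = v
          · subst hw; simp
          · simp [hw]
        rw [e, e]
        exact (hv _ _).2 hab t
      · have e : ∀ c : Fin K × V → Fin 2, (fun w => Function.update c (i, v) t (j, w)) =
            fun w => c (j, w) := by
          intro c
          ext1 w
          have : (j, w) ≠ (i, v) := fun h => hij (congrArg Prod.fst h).symm
          simp [this]
        rw [e, e]
    · rfl

/-- Labels on one block, extended by zero to all blocks. -/
def embedLabels (j : Fin K) (v : V → PauliLabel) : Fin K × V → PauliLabel :=
  fun p => if p.1 = j then v p.2 else 0

theorem blockOp_pauliW (j : Fin K) (v : V → PauliLabel) :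
    blockOp j (pauliW v) = pauliW (embedLabels j v) := by
  ext a b
  simp only [blockOp, pauliW, tensorOp, Matrix.of_apply]
  rw [Fintype.prod_prod_type]
  split_ifs with h
  · rw [Finset.prod_eq_single j]
    · simp [embedLabels]
    · intro i _ hi
      refine Finset.prod_eq_one fun q _ => ?_
      simp only [embedLabels, if_neg hi, pauli1_zero]
      rw [h (i, q) hi, Matrix.one_apply_eq]
    · simp
  · push Not at h
    obtain ⟨⟨i, q⟩, hi, hne⟩ := h
    symm
    refine Finset.prod_eq_zero (Finset.mem_univ i) (Finset.prod_eq_zero (Finset.mem_univ q) ?_)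
    simp only at hi
    simp only [embedLabels, if_neg hi, pauli1_zero]
    rw [Matrix.one_apply_ne hne]

theorem symp_embedLabels (j : Fin K) (v : Fin K × V → PauliLabel) (w : V → PauliLabel) :
    symp v (embedLabels j w) = symp (fun q => v (j, q)) w := by
  unfold symp
  rw [Fintype.sum_prod_type, Finset.sum_eq_single j]
  · simp [embedLabels]
  · intro i _ hi
    simp [embedLabels, hi, symp1]
  · simp

theorem blockCopies_subset_pauliGroup {S : Set (QOp V)} (hS : S ⊆ pauliGroup V) :
    blockCopies K S ⊆ pauliGroup (Fin K × V) := by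
  rintro _ ⟨j, s, hs, rfl⟩
  obtain ⟨c, hc, v, rfl⟩ := mem_pauliGroup_iff.1 (hS hs)
  rw [blockOp_smul, blockOp_pauliW]
  exact mem_pauliGroup_iff.2 ⟨c, hc, _, rfl⟩

theorem blockOp_mem_closure [DecidableEq V] (j : Fin K) {S : Set (QOp V)} {M : QOp V}
    (hM : M ∈ Submonoid.closure S) : blockOp j M ∈ Submonoid.closure (blockCopies K S) := by
  induction hM using Submonoid.closure_induction with
  | mem x hx => exact Submonoid.subset_closure ⟨j, x, hx, rfl⟩
  | one => rw [blockOp_one]; exact one_mem _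
  | mul x y _ _ hx hy => rw [blockOp_mul]; exact mul_mem hx hy

theorem symp_comm {Q : Type*} [Fintype Q] (v w : Q → PauliLabel) : symp v w = symp w v :=
  Finset.sum_congr rfl fun q _ => by simp only [symp1]; ring

end BlockOp

/-! ### Correctable regions and the cleaning lemma -/

section Cleaning

variable {Q : Type*} [Fintype Q] [DecidableEq Q]

/-- The labels of the stabilizers. -/
def stabLabels (T : Set (QOp Q)) : Submodule (ZMod 2) (Q → PauliLabel) where
  carrier := {v | ∃ c ∈ pauliPhases, c • pauliW v ∈ Submonoid.closure T}
  zero_mem' := ⟨1, one_mem_pauliPhases, by rw [one_smul, pauliW_zero]; exact one_mem _⟩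
  add_mem' := by
    rintro v w ⟨c, hc, hv⟩ ⟨d, hd, hw⟩
    obtain ⟨e, he, h⟩ := pauliW_mul v w
    refine ⟨c * d * e, mul_mem_pauliPhases (mul_mem_pauliPhases hc hd) he, ?_⟩
    have := mul_mem hv hw
    rwa [smul_mul_smul_comm, h, smul_smul] at this
  smul_mem' := by
    rintro t v ⟨c, hc, hv⟩
    rcases zmod2_cases t with rfl | rfl
    · exact ⟨1, one_mem_pauliPhases, by rw [zero_smul, one_smul, pauliW_zero]; exact one_mem _⟩
    · exact ⟨c, hc, by rwa [one_smul]⟩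

/-- A region is correctable if every logical Pauli operator supported on it is trivial. -/
def Correctable (T : Set (QOp Q)) (A : Set Q) : Prop :=
  ∀ v : Q → PauliLabel, (∀ s ∈ T, Commute (pauliW v) s) → (∀ q, q ∉ A → v q = 0) →
    v ∈ stabLabels T

/-- The symplectic form as a bilinear form. -/
def sympForm (Q : Type*) [Fintype Q] : LinearMap.BilinForm (ZMod 2) (Q → PauliLabel) :=
  LinearMap.mk₂ (ZMod 2) symp
    (fun u v w => by
      simp only [symp, ← Finset.sum_add_distrib]
      exact Finset.sum_congr rfl fun q _ => by simp [symp1]; ring)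
    (fun c u w => by
      simp only [symp, smul_eq_mul, Finset.mul_sum]
      exact Finset.sum_congr rfl fun q _ => by simp [symp1]; ring)
    (fun u v w => by
      simp only [symp, ← Finset.sum_add_distrib]
      exact Finset.sum_congr rfl fun q _ => by simp [symp1]; ring)
    (fun c u w => by
      simp only [symp, smul_eq_mul, Finset.mul_sum]
      exact Finset.sum_congr rfl fun q _ => by simp [symp1]; ring)

theorem sympForm_isRefl {Q : Type*} [Fintype Q] : (sympForm Q).IsRefl := fun v w h => by
  have h' : symp v w = 0 := h
  rw [symp_comm] at h'
  exact h'

theorem sympForm_nondegenerate : (sympForm Q).Nondegenerate := by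
  refine (LinearMap.IsRefl.nondegenerate_iff_separatingLeft sympForm_isRefl).2 ?_
  intro v hv
  ext1 q
  exact symp1_eq_zero fun u => by rw [← symp_single]; exact hv _

theorem commute_of_mem_stabLabels {T : Set (QOp Q)} {v w : Q → PauliLabel}
    (hv : ∀ s ∈ T, Commute (pauliW v) s) (hw : w ∈ stabLabels T) : symp v w = 0 := by
  obtain ⟨c, hc, hcw⟩ := hw
  have h : Commute (pauliW v) (c • pauliW w) := by
    generalize c • pauliW w = M at hcw
    induction hcw using Submonoid.closure_induction with
    | mem x hx => exact hv x hx
    | one => exact Commute.one_right _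
    | mul x y _ _ hx hy => exact hx.mul_right hy
  have hc0 : c ≠ 0 := by
    have := norm_of_mem_pauliPhases hc
    rintro rfl
    simp at this
  exact pauliW_commute_iff.1 ((Commute.smul_right_iff₀ hc0).1 h)

/-- The cleaning lemma: a logical Pauli operator can be moved off a correctable region. -/
theorem Correctable.exists_clean {T : Set (QOp Q)} (hT : T ⊆ pauliGroup Q) {A : Set Q}
    (hA : Correctable T A) {v : Q → PauliLabel} (hv : ∀ s ∈ T, Commute (pauliW v) s) :
    ∃ w ∈ stabLabels T, ∀ q ∈ A, (v + w) q = 0 := by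
  let W : Submodule (ZMod 2) (Q → PauliLabel) :=
    { carrier := {w | ∀ q ∈ A, w q = 0}
      zero_mem' := fun _ _ => rfl
      add_mem' := fun {x y} hx hy q hq => by rw [Pi.add_apply, hx q hq, hy q hq, add_zero]
      smul_mem' := fun c x hx q hq => by rw [Pi.smul_apply, hx q hq, smul_zero] }
  -- By double orthogonality it suffices that `v` is orthogonal to everything orthogonal to both
  -- summands. Such a `u` commutes with the stabilizers and, being orthogonal to `W`, is supported
  -- on `A`. Correctability makes `u` a stabilizer, with which `v` commutes.
  have hmem : v ∈ stabLabels T ⊔ W := by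
    rw [← LinearMap.BilinForm.orthogonal_orthogonal sympForm_nondegenerate sympForm_isRefl
      (stabLabels T ⊔ W)]
    rw [LinearMap.BilinForm.mem_orthogonal_iff]
    intro u hu
    rw [LinearMap.BilinForm.mem_orthogonal_iff] at hu
    have hu1 : ∀ w ∈ stabLabels T, symp u w = 0 := fun w hw => by
      rw [symp_comm]
      exact hu w (Submodule.mem_sup_left hw)
    have hu2 : ∀ q, q ∉ A → u q = 0 := by
      intro q hq
      refine symp1_eq_zero fun x => ?_
      rw [← symp_single, symp_comm]
      refine hu _ (Submodule.mem_sup_right ?_)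
      intro q' hq'
      have : q' ≠ q := fun h => hq (h ▸ hq')
      simp [this]
    have hu3 : u ∈ stabLabels T := by
      refine hA u (fun s hs => ?_) hu2
      obtain ⟨c, hc, t, rfl⟩ := mem_pauliGroup_iff.1 (hT hs)
      exact (pauliW_commute_iff.2 (hu1 t ⟨c, hc, Submonoid.subset_closure hs⟩)).smul_right c
    have h := commute_of_mem_stabLabels hv hu3
    rw [symp_comm] at h
    exact h
  obtain ⟨w, hw, x, hx, hwx⟩ := Submodule.mem_sup.1 hmem
  refine ⟨w, hw, fun q hq => ?_⟩
  rw [← hwx]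
  have h2 : ∀ y : PauliLabel, y + y = 0 := by decide
  simp only [Pi.add_apply]
  rw [hx q hq, add_zero, h2]

variable {V : Type*} [Fintype V] [DecidableEq V] {K : ℕ}

/-- Scattered pieces of size below the code distance form a correctable region. -/
theorem Fragmented.correctable {S : Set (QOp V)} (hS : S ⊆ pauliGroup V) {d R : ℕ}
    (hd : (d : ℕ∞) ≤ codeDistance S) {A : Set V}
    (hA : Fragmented (connectivityGraph S) 1 R A)
    (hball : ∀ x, (ballIn (connectivityGraph S) Finset.univ x R).card < d) :
    Correctable (blockCopies K S) {p : Fin K × V | p.2 ∈ A} := by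
  obtain ⟨f, h1, h2⟩ := hA
  intro v hv hvA
  -- The restriction of `v` to block `j` and to the vertices labelled `x`.
  let piece : Fin K → V → V → PauliLabel := fun j x q => if f q = x then v (j, q) else 0
  have hpiece_supp : ∀ j x q, piece j x q ≠ 0 → q ∈ A ∧ f q = x := by
    intro j x q hq
    by_cases hfx : f q = x
    · refine ⟨?_, hfx⟩
      by_contra hqA
      exact hq (by simp only [piece, hfx, if_true]; exact hvA (j, q) hqA)
    · exact absurd (by simp [piece, hfx]) hq
  have hcomm : ∀ j x, ∀ s ∈ S, Commute (pauliW (piece j x)) s := by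
    intro j x s hs
    obtain ⟨c, hc, t, rfl⟩ := mem_pauliGroup_iff.1 (hS hs)
    have hc0 : c ≠ 0 := by
      have := norm_of_mem_pauliPhases hc
      rintro rfl
      simp at this
    refine (pauliW_commute_iff.2 ?_).smul_right c
    -- A generator that meets the vertices of this piece meets no other piece, since two qubits of
    -- one generator are adjacent. Its form with the piece therefore equals its form with all of `v`
    -- in block `j`, which vanishes.
    by_cases hex : ∃ u ∈ A, f u = x ∧ t u ≠ 0
    · obtain ⟨u, huA, hux, hut⟩ := hex
      have hvj : symp (fun q => v (j, q)) t = 0 := by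
        rw [← symp_embedLabels, ← pauliW_commute_iff]
        have h3 := hv _ ⟨j, _, hs, rfl⟩
        rw [blockOp_smul, blockOp_pauliW] at h3
        exact (Commute.smul_right_iff₀ hc0).1 h3
      rw [← hvj]
      refine Finset.sum_congr rfl fun q _ => ?_
      by_cases hfq : f q = x
      · simp [piece, hfq]
      · simp only [piece, if_neg hfq]
        by_cases hqA : q ∈ A
        · have hlt := h2 u huA q hqA (by rw [hux]; exact Ne.symm hfq)
          by_cases htq : t q = 0
          · simp [htq, symp1]
          · exfalso
            have huq : u ≠ q := by
              rintro rfl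
              exact hfq hux
            have hadj : (connectivityGraph S).Adj u q := by
              refine ⟨huq, _, hs, ?_, ?_⟩
              · rw [support_pauliW hc0]; exact hut
              · rw [support_pauliW hc0]; exact htq
            rw [SimpleGraph.dist_eq_one_iff_adj.2 hadj] at hlt
            exact lt_irrefl _ hlt
        · rw [hvA (j, q) hqA]
    · refine Finset.sum_eq_zero fun q _ => ?_
      by_cases hq : piece j x q = 0
      · simp [hq, symp1]
      · obtain ⟨hqA, hfq⟩ := hpiece_supp j x q hq
        have : t q = 0 := by
          by_contra htq
          exact hex ⟨q, hqA, hfq, htq⟩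
        simp [this, symp1]
  -- A piece fits into one ball, so its weight is below the code distance and it cannot be a
  -- nontrivial logical operator.
  have hstab : ∀ j x, piece j x ∈ stabLabels S := by
    intro j x
    by_contra hcon
    have hlog : pauliW (piece j x) ∈ nontrivialLogicals S :=
      ⟨pauliW_mem_pauliGroup _, fun s hs => (hcomm j x s hs).eq.symm,
        fun c hc hmem => hcon ⟨c, hc, hmem⟩⟩
    have hle : (d : ℕ∞) ≤ (support (pauliW (piece j x))).encard :=
      hd.trans (iInf₂_le _ hlog)
    have hsub : support (pauliW (piece j x)) ⊆
        (ballIn (connectivityGraph S) Finset.univ x R : Set V) := by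
      intro q hq
      rw [← one_smul ℂ (pauliW _), support_pauliW one_ne_zero] at hq
      obtain ⟨hqA, hfq⟩ := hpiece_supp j x q hq
      simp only [ballIn, Finset.coe_filter, Finset.mem_univ, true_and]
      have := h1 q hqA
      rwa [hfq] at this
    have h3 := hle.trans (Set.encard_le_encard hsub)
    rw [Set.encard_coe_eq_coe_finsetCard] at h3
    exact absurd (hball x) (not_lt.2 (by exact_mod_cast h3))
  have hemb : ∀ j x, embedLabels j (piece j x) ∈ stabLabels (blockCopies K S) := by
    intro j x
    obtain ⟨c, hc, h⟩ := hstab j x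
    refine ⟨c, hc, ?_⟩
    rw [← blockOp_pauliW, ← blockOp_smul]
    exact blockOp_mem_closure j h
  have hsum : v = ∑ j, ∑ x, embedLabels j (piece j x) := by
    ext1 ⟨i, q⟩
    simp only [Finset.sum_apply]
    rw [Finset.sum_eq_single i, Finset.sum_eq_single (f q)]
    · simp [embedLabels, piece]
    · intro x _ hx
      simp [embedLabels, piece, hx.symm]
    · simp
    · intro j _ hj
      simp [embedLabels, hj.symm]
    · simp
  rw [hsum]
  exact Submodule.sum_mem _ fun j _ => Submodule.sum_mem _ fun x _ => hemb j x

end Cleaning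

/-! ### Spreading of operators under conjugation -/

section Spread

variable {Q : Type*} [Fintype Q] [DecidableEq Q]

theorem SupportedOn.inter {Q : Type*} [DecidableEq Q] {M : QOp Q} {A B : Set Q} (hA : SupportedOn M A)
    (hB : SupportedOn M B) : SupportedOn M (A ∩ B) := fun q hq => by
  by_cases h : q ∈ A
  · exact hB q fun h' => hq ⟨h, h'⟩
  · exact hA q h

theorem conjTranspose_mul_of_unitary {n : Type*} [Fintype n] [DecidableEq n] {U : Matrix n n ℂ}
    (hU : U ∈ Matrix.unitaryGroup n ℂ) : U.conjTranspose * U = 1 := by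
  rwa [Matrix.mem_unitaryGroup_iff', Matrix.star_eq_conjTranspose] at hU

theorem mul_conjTranspose_of_unitary {n : Type*} [Fintype n] [DecidableEq n] {U : Matrix n n ℂ}
    (hU : U ∈ Matrix.unitaryGroup n ℂ) : U * U.conjTranspose = 1 := by
  rwa [Matrix.mem_unitaryGroup_iff, Matrix.star_eq_conjTranspose] at hU

theorem conjTranspose_unitary {n : Type*} [Fintype n] [DecidableEq n] {U : Matrix n n ℂ}
    (hU : U ∈ Matrix.unitaryGroup n ℂ) : U.conjTranspose ∈ Matrix.unitaryGroup n ℂ := by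
  rw [Matrix.mem_unitaryGroup_iff, Matrix.star_eq_conjTranspose, Matrix.conjTranspose_conjTranspose]
  exact conjTranspose_mul_of_unitary hU

/-- Conjugation by a Pauli operator preserves supports. -/
theorem SupportedOn.conj_pauli {M P : QOp Q} {A : Set Q} (hM : SupportedOn M A)
    (hP : P ∈ pauliGroup Q) : SupportedOn (P * M * P.conjTranspose) A := by
  intro q hq
  rw [actsTriviallyAt_iff]
  intro u
  have hMu := (actsTriviallyAt_iff _ _).1 (hM q hq) u
  obtain ⟨c, hc, v, rfl⟩ := mem_pauliGroup_iff.1 hP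
  rw [Matrix.conjTranspose_smul, pauliW_conjTranspose, smul_mul_assoc, smul_mul_smul_comm]
  refine Commute.smul_left ?_ _
  set w : Q → PauliLabel := Pi.single q u
  have h1 : pauliW v * pauliW w = sgn (symp v w) • (pauliW w * pauliW v) := pauliW_comm v w
  have h2 : sgn (symp v w) * sgn (symp v w) = 1 := by
    rcases zmod2_cases (symp v w) with h | h <;> simp [h, sgn_zero, sgn_one]
  change pauliW v * M * pauliW v * pauliW w = pauliW w * (pauliW v * M * pauliW v)
  calc pauliW v * M * pauliW v * pauliW w
      = pauliW v * M * (pauliW v * pauliW w) := by rw [mul_assoc]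
    _ = sgn (symp v w) • (pauliW v * (M * pauliW w) * pauliW v) := by
        rw [h1, mul_smul_comm]; simp only [mul_assoc]
    _ = sgn (symp v w) • (pauliW v * pauliW w * M * pauliW v) := by
        rw [hMu.eq]; simp only [mul_assoc]
    _ = pauliW w * (pauliW v * M * pauliW v) := by
        rw [h1, smul_mul_assoc, smul_mul_assoc, smul_smul, h2, one_smul]
        simp only [mul_assoc]

/-- A gate that misses `A` also misses every other gate of the layer, hence the support reached so
far. It commutes with the conjugated operator and cancels against its adjoint, so only gates meeting
`A` spread it. -/
theorem SupportedOn.conj_layer (gs : List (QOp Q))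
    (hu : ∀ g ∈ gs, g ∈ Matrix.unitaryGroup (Q → Fin 2) ℂ)
    (hd : gs.Pairwise fun g h => Disjoint (support g) (support h)) {O : QOp Q} {A : Set Q}
    (hO : SupportedOn O A) :
    SupportedOn (gs.prod * O * gs.prod.conjTranspose)
      (A ∪ {p | ∃ g ∈ gs, p ∈ support g ∧ ∃ q ∈ A, q ∈ support g}) := by
  induction gs with
  | nil =>
    simp only [List.prod_nil, Matrix.conjTranspose_one, one_mul, mul_one]
    exact hO.mono Set.subset_union_left
  | cons g gs ih =>
    rw [List.pairwise_cons] at hd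
    have ih' := ih (fun k hk => hu k (List.mem_cons_of_mem _ hk)) hd.2
    set X := gs.prod * O * gs.prod.conjTranspose with hX
    have e : (g :: gs).prod * O * (g :: gs).prod.conjTranspose = g * X * g.conjTranspose := by
      rw [List.prod_cons, Matrix.conjTranspose_mul, hX]
      simp only [mul_assoc]
    rw [e]
    by_cases hmeet : ∃ q ∈ A, q ∈ support g
    · have hgs : SupportedOn g (A ∪ {p | ∃ k ∈ g :: gs, p ∈ support k ∧ ∃ q ∈ A, q ∈ support k}) :=
        (supportedOn_support g).mono fun p hp => Or.inr ⟨g, List.mem_cons_self, hp, hmeet⟩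
      refine (hgs.mul (ih'.mono ?_)).mul hgs.conjTranspose
      rintro p (hp | ⟨k, hk, hp⟩)
      · exact Or.inl hp
      · exact Or.inr ⟨k, List.mem_cons_of_mem _ hk, hp⟩
    · have hdisj : Disjoint (support g)
          (A ∪ {p | ∃ k ∈ gs, p ∈ support k ∧ ∃ q ∈ A, q ∈ support k}) := by
        rw [Set.disjoint_left]
        rintro p hp (hpA | ⟨k, hk, hpk, -⟩)
        · exact hmeet ⟨p, hpA, hp⟩
        · exact Set.disjoint_left.1 (hd.1 k hk) hp hpk
      have hcomm := (supportedOn_support g).commute ih' hdisj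
      rw [hcomm.eq, mul_assoc, mul_conjTranspose_of_unitary (hu g List.mem_cons_self), mul_one]
      refine ih'.mono ?_
      rintro p (hp | ⟨k, hk, hp⟩)
      · exact Or.inl hp
      · exact Or.inr ⟨k, List.mem_cons_of_mem _ hk, hp⟩

end Spread

/-! ### Range of circuits, projected to one block -/

section Range

variable {V : Type*} [Fintype V] [DecidableEq V] {K : ℕ}

/-- The qubits of all blocks that lie over `A`. -/
def cyl (K : ℕ) {V : Type*} (A : Set V) : Set (Fin K × V) := {p | p.2 ∈ A}

theorem nbhd_nbhd_subset {V : Type*} {G : SimpleGraph V} (hG : G.Connected) (r s : ℕ) (A : Set V) :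
    nbhd G r (nbhd G s A) ⊆ nbhd G (r + s) A := by
  rintro v ⟨u, ⟨t, ht, htu⟩, huv⟩
  have := hG.dist_triangle (u := t) (v := u) (w := v)
  exact ⟨t, ht, by omega⟩

theorem nbhd_mono {V : Type*} {G : SimpleGraph V} {r s : ℕ} (h : r ≤ s) (A : Set V) :
    nbhd G r A ⊆ nbhd G s A := fun _ ⟨u, hu, hd⟩ => ⟨u, hu, hd.trans h⟩

theorem subset_nbhd {V : Type*} {G : SimpleGraph V} (r : ℕ) (A : Set V) : A ⊆ nbhd G r A :=
  fun v hv => ⟨v, hv, by simp⟩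

/-- `U` is a unitary such that conjugation by `U` and by its adjoint spreads the support of
operators, projected to one block, by at most `r`. -/
def HasRange (G : SimpleGraph V) (r : ℕ) (U : QOp (Fin K × V)) : Prop :=
  U ∈ Matrix.unitaryGroup (Fin K × V → Fin 2) ℂ ∧
  ∀ (A : Set V) (O : QOp (Fin K × V)), SupportedOn O (cyl K A) →
    SupportedOn (U * O * U.conjTranspose) (cyl K (nbhd G r A)) ∧
    SupportedOn (U.conjTranspose * O * U) (cyl K (nbhd G r A))

theorem HasRange.mono {G : SimpleGraph V} {r s : ℕ} {U : QOp (Fin K × V)} (h : HasRange G r U)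
    (hrs : r ≤ s) : HasRange G s U :=
  ⟨h.1, fun A O hO => ⟨(h.2 A O hO).1.mono fun _ hp => nbhd_mono hrs A hp,
    (h.2 A O hO).2.mono fun _ hp => nbhd_mono hrs A hp⟩⟩

theorem HasRange.conjTranspose {G : SimpleGraph V} {r : ℕ} {U : QOp (Fin K × V)}
    (h : HasRange G r U) : HasRange G r U.conjTranspose := by
  refine ⟨conjTranspose_unitary h.1, fun A O hO => ?_⟩
  rw [Matrix.conjTranspose_conjTranspose]
  exact (h.2 A O hO).symm

theorem HasRange.mul {G : SimpleGraph V} (hG : G.Connected) {r s : ℕ} {U W : QOp (Fin K × V)}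
    (hU : HasRange G r U) (hW : HasRange G s W) : HasRange G (r + s) (U * W) := by
  refine ⟨mul_mem hU.1 hW.1, fun A O hO => ⟨?_, ?_⟩⟩
  · have h := (hU.2 _ _ (hW.2 A O hO).1).1
    have e : U * W * O * (U * W).conjTranspose =
        U * (W * O * W.conjTranspose) * U.conjTranspose := by
      rw [Matrix.conjTranspose_mul]; simp only [mul_assoc]
    rw [e]
    exact h.mono fun _ hp => nbhd_nbhd_subset hG r s A hp
  · have h := (hW.2 _ _ (hU.2 A O hO).2).2
    have e : (U * W).conjTranspose * O * (U * W) =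
        W.conjTranspose * (U.conjTranspose * O * U) * W := by
      rw [Matrix.conjTranspose_mul]; simp only [mul_assoc]
    rw [e, add_comm]
    exact h.mono fun _ hp => nbhd_nbhd_subset hG s r A hp

theorem hasRange_pauli (G : SimpleGraph V) {P : QOp (Fin K × V)}
    (hP : P ∈ pauliGroup (Fin K × V)) : HasRange G 0 P := by
  refine ⟨pauliGroup_unitary hP, fun A O hO => ⟨?_, ?_⟩⟩
  · exact (hO.conj_pauli hP).mono fun _ hp => subset_nbhd 0 A hp
  · have h := hO.conj_pauli (pauliGroup_conjTranspose hP)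
    rw [Matrix.conjTranspose_conjTranspose] at h
    exact h.mono fun _ hp => subset_nbhd 0 A hp

/-- A gate whose support has projected diameter at most `r`. -/
def IsShortGate (G : SimpleGraph V) (r : ℕ) (g : QOp (Fin K × V)) : Prop :=
  g ∈ Matrix.unitaryGroup (Fin K × V → Fin 2) ℂ ∧
  ∀ p ∈ support g, ∀ q ∈ support g, G.dist p.2 q.2 ≤ r

theorem IsShortGate.conjTranspose {G : SimpleGraph V} {r : ℕ} {g : QOp (Fin K × V)}
    (hg : IsShortGate G r g) : IsShortGate G r g.conjTranspose := by
  have hs := (supportedOn_support g).conjTranspose.support_subset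
  exact ⟨conjTranspose_unitary hg.1, fun p hp q hq => hg.2 p (hs hp) q (hs hq)⟩

theorem conj_layer_spread {G : SimpleGraph V} {r : ℕ} (gs : List (QOp (Fin K × V)))
    (hg : ∀ g ∈ gs, IsShortGate G r g)
    (hd : gs.Pairwise fun g h => Disjoint (support g) (support h)) (A : Set V)
    {O : QOp (Fin K × V)} (hO : SupportedOn O (cyl K A)) :
    SupportedOn (gs.prod * O * gs.prod.conjTranspose) (cyl K (nbhd G r A)) := by
  refine (hO.conj_layer gs (fun g h => (hg g h).1) hd).mono ?_
  rintro p (hp | ⟨g, hgs, hp, q, hqA, hq⟩)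
  · exact subset_nbhd r A hp
  · exact ⟨q.2, hqA, (hg g hgs).2 q hq p hp⟩

theorem hasRange_layer {G : SimpleGraph V} {r : ℕ} {𝒢 : Set (QOp (Fin K × V))}
    (hg : ∀ g ∈ 𝒢, IsShortGate G r g) {U : QOp (Fin K × V)} (hU : IsLayer 𝒢 U) :
    HasRange G r U := by
  obtain ⟨gs, hgs, hd, rfl⟩ := hU
  refine ⟨Submonoid.list_prod_mem _ fun g h => (hg g (hgs g h)).1, fun A O hO => ⟨?_, ?_⟩⟩
  · exact conj_layer_spread gs (fun g h => hg g (hgs g h)) hd A hO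
  -- The adjoint of a layer is the layer of adjoint gates in reverse order.
  · have h := conj_layer_spread (G := G) (r := r) (gs.map Matrix.conjTranspose).reverse ?_ ?_ A hO
    · rwa [← Matrix.conjTranspose_list_prod, Matrix.conjTranspose_conjTranspose] at h
    · intro g h
      rw [List.mem_reverse, List.mem_map] at h
      obtain ⟨k, hk, rfl⟩ := h
      exact (hg k (hgs k hk)).conjTranspose
    · rw [List.pairwise_reverse, List.pairwise_map]
      refine hd.imp fun {g k} hgk => ?_
      exact (hgk.mono (supportedOn_support g).conjTranspose.support_subset
        (supportedOn_support k).conjTranspose.support_subset).symm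

theorem hasRange_circuit {G : SimpleGraph V} (hG : G.Connected) {r h : ℕ}
    {𝒢 : Set (QOp (Fin K × V))} (hg : ∀ g ∈ 𝒢, IsShortGate G r g) {U : QOp (Fin K × V)}
    (hU : IsCircuit 𝒢 h U) : HasRange G (h * r) U := by
  obtain ⟨Ls, hlen, hLs, rfl⟩ := hU
  suffices H : HasRange G (Ls.length * r) Ls.prod from H.mono (Nat.mul_le_mul_right r hlen)
  clear hlen
  induction Ls with
  | nil =>
    rw [List.prod_nil, ← pauliW_zero]
    exact (hasRange_pauli G (pauliW_mem_pauliGroup _)).mono (Nat.zero_le _)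
  | cons L Ls ih =>
    have h1 := (hasRange_layer hg (hLs L List.mem_cons_self)).mul hG
      (ih fun L' h => hLs L' (List.mem_cons_of_mem _ h))
    rw [List.prod_cons]
    exact h1.mono (by rw [List.length_cons]; ring_nf; exact le_rfl)

end Range

/-! ### The Clifford hierarchy up to phases -/

section Hierarchy

variable {Q : Type*} [Fintype Q] [DecidableEq Q]

/-- The hierarchy defined by group commutators with Pauli strings, starting from the phases. -/
def commutatorLevel (Q : Type*) [Fintype Q] [DecidableEq Q] : ℕ → Set (QOp Q)
  | 0 => {L | ∃ c : ℂ, ‖c‖ = 1 ∧ L = c • (1 : QOp Q)}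
  | l + 1 => {L | L ∈ Matrix.unitaryGroup (Q → Fin 2) ℂ ∧
      ∀ v, L * pauliW v * L.conjTranspose * pauliW v ∈ commutatorLevel Q l}

theorem smul_unitary {L : QOp Q} (hL : L ∈ Matrix.unitaryGroup (Q → Fin 2) ℂ) {c : ℂ}
    (hc : ‖c‖ = 1) : c • L ∈ Matrix.unitaryGroup (Q → Fin 2) ℂ := by
  rw [Matrix.mem_unitaryGroup_iff, Matrix.star_eq_conjTranspose, Matrix.conjTranspose_smul,
    smul_mul_smul_comm, mul_conjTranspose_of_unitary hL, ← starRingEnd_apply, Complex.mul_conj,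
    Complex.normSq_eq_norm_sq, hc]
  simp

theorem norm_eq_one_of_smul_unitary {c : ℂ}
    (h : c • (1 : QOp Q) ∈ Matrix.unitaryGroup (Q → Fin 2) ℂ) : ‖c‖ = 1 := by
  have h1 := mul_conjTranspose_of_unitary h
  rw [Matrix.conjTranspose_smul, smul_mul_smul_comm, ← starRingEnd_apply, Complex.mul_conj,
    Matrix.conjTranspose_one, mul_one, Complex.normSq_eq_norm_sq] at h1
  have h2 := congrFun (congrFun h1 0) 0
  simp only [Matrix.smul_apply, Matrix.one_apply_eq, smul_eq_mul, mul_one] at h2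
  have h3 : ‖c‖ ^ 2 = 1 := by exact_mod_cast h2
  exact (pow_eq_one_iff_of_nonneg (norm_nonneg c) two_ne_zero).1 h3

theorem smul_mem_commutatorLevel {l : ℕ} {L : QOp Q} (hL : L ∈ commutatorLevel Q l) {c : ℂ}
    (hc : ‖c‖ = 1) : c • L ∈ commutatorLevel Q l := by
  cases l with
  | zero =>
    obtain ⟨d, hd, rfl⟩ := hL
    exact ⟨c * d, by rw [norm_mul, hc, hd, one_mul], smul_smul _ _ _⟩
  | succ l =>
    refine ⟨smul_unitary hL.1 hc, fun v => ?_⟩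
    have e : c • L * pauliW v * (c • L).conjTranspose * pauliW v =
        L * pauliW v * L.conjTranspose * pauliW v := by
      rw [Matrix.conjTranspose_smul, smul_mul_assoc, smul_mul_smul_comm, ← starRingEnd_apply,
        Complex.mul_conj, Complex.normSq_eq_norm_sq, hc]
      simp
    rw [e]
    exact hL.2 v

/-- A Pauli factor on the right changes each commutator only by a sign. The level must be positive,
because phases are not closed under multiplication by Pauli strings. -/
theorem mul_pauliW_mem_commutatorLevel {l : ℕ} {L : QOp Q} (hL : L ∈ commutatorLevel Q (l + 1))
    (w : Q → PauliLabel) : L * pauliW w ∈ commutatorLevel Q (l + 1) := by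
  refine ⟨mul_mem hL.1 (pauliGroup_unitary (pauliW_mem_pauliGroup w)), fun v => ?_⟩
  have e : L * pauliW w * pauliW v * (L * pauliW w).conjTranspose * pauliW v =
      sgn (symp w v) • (L * pauliW v * L.conjTranspose * pauliW v) := by
    rw [Matrix.conjTranspose_mul, pauliW_conjTranspose]
    calc L * pauliW w * pauliW v * (pauliW w * L.conjTranspose) * pauliW v
        = L * (pauliW w * pauliW v) * pauliW w * L.conjTranspose * pauliW v := by
          simp only [mul_assoc]
      _ = sgn (symp w v) • (L * pauliW v * (pauliW w * pauliW w) * L.conjTranspose * pauliW v) := by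
          rw [pauliW_comm w v]
          simp only [mul_smul_comm, smul_mul_assoc, mul_assoc]
      _ = _ := by rw [pauliW_mul_self, mul_one]
  rw [e]
  exact smul_mem_commutatorLevel (hL.2 v) (norm_sgn _)

theorem conj_mem_commutatorLevel {l : ℕ} {L : QOp Q} (hL : L ∈ commutatorLevel Q (l + 2))
    (v : Q → PauliLabel) : L * pauliW v * L.conjTranspose ∈ commutatorLevel Q (l + 1) := by
  have h := mul_pauliW_mem_commutatorLevel (hL.2 v) v
  rwa [mul_assoc, pauliW_mul_self, mul_one] at h

theorem conj_pauliW_mul_self {L : QOp Q} (hL : L ∈ Matrix.unitaryGroup (Q → Fin 2) ℂ)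
    (v : Q → PauliLabel) :
    L * pauliW v * L.conjTranspose * (L * pauliW v * L.conjTranspose) = 1 := by
  calc L * pauliW v * L.conjTranspose * (L * pauliW v * L.conjTranspose)
      = L * pauliW v * (L.conjTranspose * L) * pauliW v * L.conjTranspose := by
        simp only [mul_assoc]
    _ = L * (pauliW v * pauliW v) * L.conjTranspose := by
        rw [conjTranspose_mul_of_unitary hL, mul_one]; simp only [mul_assoc]
    _ = 1 := by rw [pauliW_mul_self, mul_one, mul_conjTranspose_of_unitary hL]

/-- A conjugated Pauli string squares to `1`. Comparing squares reduces an unknown phase to a sign,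
which is how conjugates land in the Pauli group with its four phases. -/
theorem eq_sgn_of_smul_pauliW_sq {c : ℂ} {v : Q → PauliLabel}
    (h : c • pauliW v * c • pauliW v = 1) : ∃ t, c = sgn t := by
  rw [smul_mul_smul_comm, pauliW_mul_self] at h
  have h2 := congrFun (congrFun h 0) 0
  simp only [Matrix.smul_apply, Matrix.one_apply_eq, smul_eq_mul, mul_one] at h2
  rcases mul_self_eq_one_iff.1 h2 with h3 | h3
  · exact ⟨0, by rw [h3, sgn_zero]⟩
  · exact ⟨1, by rw [h3, sgn_one]⟩

theorem commute_single_of_generators {M : QOp Q} {q : Q}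
    (hX : Commute M (pauliW (Pi.single q (1, 0)))) (hZ : Commute M (pauliW (Pi.single q (0, 1))))
    (u : PauliLabel) : Commute M (pauliW (Pi.single q u)) := by
  obtain ⟨x, z⟩ := u
  rcases zmod2_cases x with rfl | rfl <;> rcases zmod2_cases z with rfl | rfl
  · have : (Pi.single q ((0, 0) : PauliLabel) : Q → PauliLabel) = 0 := Pi.single_zero q
    rw [this, pauliW_zero]
    exact Commute.one_right M
  · exact hZ
  · exact hX
  · obtain ⟨c, hc, h⟩ := pauliW_mul (Pi.single q ((1, 0) : PauliLabel)) (Pi.single q (0, 1))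
    have hc0 : c ≠ 0 := by
      have := norm_of_mem_pauliPhases hc
      rintro rfl
      simp at this
    rw [← Pi.single_add] at h
    have h3 := hX.mul_right hZ
    rw [h] at h3
    simpa using (Commute.smul_right_iff₀ hc0).1 h3

/-- Unitaries that commute with all Pauli operators up to phases are Pauli operators up to a
phase. -/
theorem eq_smul_pauliW_of_mem_commutatorLevel_one {L : QOp Q} (hL : L ∈ commutatorLevel Q 1) :
    ∃ c : ℂ, ‖c‖ = 1 ∧ ∃ v, L = c • pauliW v := by
  obtain ⟨hu, hcomm⟩ := hL
  have h1 : ∀ w, ∃ t, L * pauliW w = sgn t • (pauliW w * L) := by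
    intro w
    obtain ⟨c, -, h⟩ := hcomm w
    have h2 : L * pauliW w * L.conjTranspose = c • pauliW w := by
      have := congrArg (· * pauliW w) h
      simpa [mul_assoc, pauliW_mul_self] using this
    have h3 := conj_pauliW_mul_self hu w
    rw [h2] at h3
    obtain ⟨t, rfl⟩ := eq_sgn_of_smul_pauliW_sq h3
    refine ⟨t, ?_⟩
    have := congrArg (· * L) h2
    simpa only [mul_assoc, conjTranspose_mul_of_unitary hu, mul_one, smul_mul_assoc] using this
  choose t ht using h1
  -- The string with the same commutation signs as `L`. The two components are interchanged because
  -- the symplectic form pairs `X` with `Z`; then `L * pauliW v` commutes with all single-qubit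
  -- Pauli operators and is a scalar.
  set v : Q → PauliLabel := fun q => (t (Pi.single q (0, 1)), t (Pi.single q (1, 0))) with hv
  have key : ∀ w, symp v w = t w → Commute (L * pauliW v) (pauliW w) := by
    intro w hw
    change L * pauliW v * pauliW w = pauliW w * (L * pauliW v)
    have h2 : sgn (t w) * sgn (t w) = 1 := by
      rcases zmod2_cases (t w) with h | h <;> simp [h, sgn_zero, sgn_one]
    rw [mul_assoc, pauliW_comm v w, hw, mul_smul_comm, ← mul_assoc, ht w, smul_mul_assoc,
      smul_smul, h2, one_smul, mul_assoc]
  obtain ⟨c, hc⟩ := eq_smul_one_of_commute (M := L * pauliW v) fun q u =>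
    commute_single_of_generators
      (key _ (by rw [symp_single]; simp [symp1, hv]))
      (key _ (by rw [symp_single]; simp [symp1, hv])) u
  have hun := mul_mem hu (pauliGroup_unitary (pauliW_mem_pauliGroup v))
  rw [hc] at hun
  refine ⟨c, norm_eq_one_of_smul_unitary hun, v, ?_⟩
  have := congrArg (· * pauliW v) hc
  simpa [mul_assoc, pauliW_mul_self] using this

/-- From level `2` on no phase correction is needed, since conjugation ignores the phase of `L`. At
level `1` the commutator condition permits an arbitrary phase, whereas the Pauli group has only
four. -/
theorem mem_cliffordLevel_of_mem_commutatorLevel (l : ℕ) :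
    ∀ {L : QOp Q}, L ∈ commutatorLevel Q (l + 2) → L ∈ cliffordLevel Q (l + 2) := by
  induction l with
  | zero =>
    intro L hL
    refine ⟨hL.1, fun P hP => ?_⟩
    obtain ⟨c, hc, v, rfl⟩ := mem_pauliGroup_iff.1 hP
    obtain ⟨d, -, w, hd⟩ := eq_smul_pauliW_of_mem_commutatorLevel_one (conj_mem_commutatorLevel hL v)
    have hsq := conj_pauliW_mul_self hL.1 v
    rw [hd] at hsq
    obtain ⟨t, rfl⟩ := eq_sgn_of_smul_pauliW_sq hsq
    rw [mul_smul_comm, smul_mul_assoc, hd, smul_smul]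
    refine mem_pauliGroup_iff.2 ⟨_, mul_mem_pauliPhases hc ?_, w, rfl⟩
    rcases zmod2_cases t with rfl | rfl <;> simp [sgn_zero, sgn_one, pauliPhases]
  | succ l ih =>
    intro L hL
    refine ⟨hL.1, fun P hP => ?_⟩
    obtain ⟨c, hc, v, rfl⟩ := mem_pauliGroup_iff.1 hP
    rw [mul_smul_comm, smul_mul_assoc]
    exact ih (smul_mem_commutatorLevel (conj_mem_commutatorLevel hL v)
      (norm_of_mem_pauliPhases hc))

theorem exists_smul_mem_cliffordLevel {l : ℕ} {L : QOp Q} (hL : L ∈ commutatorLevel Q l) :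
    ∃ z : ℂ, ‖z‖ = 1 ∧ z • L ∈ cliffordLevel Q l := by
  match l, hL with
  | 0, hL => exact ⟨1, by simp, by rw [one_smul]; exact hL⟩
  | 1, hL =>
    obtain ⟨c, hc, v, rfl⟩ := eq_smul_pauliW_of_mem_commutatorLevel_one hL
    refine ⟨c⁻¹, by rw [norm_inv, hc, inv_one], ?_⟩
    have hc0 : c ≠ 0 := by
      rintro rfl
      simp at hc
    rw [smul_smul, inv_mul_cancel₀ hc0, one_smul]
    exact pauliW_mem_pauliGroup v
  | l + 2, hL =>
    exact ⟨1, by simp, by rw [one_smul]; exact mem_cliffordLevel_of_mem_commutatorLevel l hL⟩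

end Hierarchy

/-! ### Logical gates -/

section Logical

variable {Q : Type*} [Fintype Q] [DecidableEq Q] {T : Set (QOp Q)} {m : ℕ}
  {E : Matrix (Q → Fin 2) (Fin m → Fin 2) ℂ}

theorem IsEncoding.closure_mul (hE : IsEncoding T E) {s : QOp Q}
    (hs : s ∈ Submonoid.closure T) : s * E = E := by
  induction hs using Submonoid.closure_induction with
  | mem s hs =>
    refine Matrix.toLin'.injective (LinearMap.ext fun x => ?_)
    have hx : Matrix.toLin' E x ∈ codeSpace T := hE.2.1 ▸ LinearMap.mem_range_self _ x
    rw [Matrix.toLin'_mul, LinearMap.comp_apply, Matrix.toLin'_apply s]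
    exact hx s hs
  | one => rw [Matrix.one_mul]
  | mul x y _ _ hx hy => rw [Matrix.mul_assoc, hy, hx]

theorem IsEncoding.left_cancel (hE : IsEncoding T E) {A B : QOp (Fin m)} (h : E * A = E * B) :
    A = B := by
  have := congrArg (E.conjTranspose * ·) h
  simpa only [← Matrix.mul_assoc, hE.1, Matrix.one_mul] using this

/-- Physical representatives of logical Pauli operators commute with the stabilizers. -/
theorem IsEncoding.commute (hE : IsEncoding T E) (hT : T ⊆ pauliGroup Q) {u : Q → PauliLabel}
    {c : ℂ} {v : Fin m → PauliLabel} (h : (c • pauliW u) * E = E * pauliW v) :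
    ∀ s ∈ T, Commute (pauliW u) s := by
  intro s hs
  have hsE := hE.closure_mul (Submonoid.subset_closure hs)
  obtain ⟨d, hd, t, rfl⟩ := mem_pauliGroup_iff.1 (hT hs)
  refine (pauliW_commute_iff.2 ?_).smul_right d
  rcases zmod2_cases (symp u t) with h0 | h1
  · exact h0
  -- If `u` anticommuted with a stabilizer, which fixes the code space, the logical operator would
  -- equal its own negative.
  · exfalso
    have hanti : (c • pauliW u) * (d • pauliW t) = -((d • pauliW t) * (c • pauliW u)) := by
      rw [smul_mul_smul_comm, pauliW_comm, h1, sgn_one, smul_mul_smul_comm, mul_comm d c]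
      simp
    have e1 : (c • pauliW u) * (d • pauliW t) * E = E * pauliW v := by
      rw [Matrix.mul_assoc, hsE, h]
    have e2 : (d • pauliW t) * (c • pauliW u) * E = E * pauliW v := by
      rw [Matrix.mul_assoc, h, ← Matrix.mul_assoc, hsE]
    rw [hanti, Matrix.neg_mul, e2, ← Matrix.mul_neg] at e1
    have h3 := hE.left_cancel e1
    have h4 : (2 : ℂ) • pauliW v = 0 := by
      rw [two_smul]
      nth_rewrite 1 [← h3]
      exact neg_add_cancel _
    exact pauliW_ne_zero v ((smul_eq_zero.1 h4).resolve_left two_ne_zero)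

/-- Every logical Pauli operator has a representative supported off a given correctable region. -/
theorem IsEncoding.exists_clean (hE : IsEncoding T E) (hT : T ⊆ pauliGroup Q) {A : Set Q}
    (hA : Correctable T A) (v : Fin m → PauliLabel) :
    ∃ P ∈ pauliGroup Q, SupportedOn P Aᶜ ∧ P * E = E * pauliW v := by
  obtain ⟨P, hP, hPE⟩ := hE.2.2 _ (pauliW_mem_pauliGroup v)
  obtain ⟨c, hc, u, rfl⟩ := mem_pauliGroup_iff.1 hP
  obtain ⟨w, ⟨d, hd, hw⟩, hclean⟩ := hA.exists_clean hT (hE.commute hT hPE)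
  obtain ⟨e, he, h⟩ := pauliW_mul u w
  have hprod : (c • pauliW u) * (d • pauliW w) = (c * d * e) • pauliW (u + w) := by
    rw [smul_mul_smul_comm, h, smul_smul]
  have hmem := mul_mem_pauliPhases (mul_mem_pauliPhases hc hd) he
  refine ⟨(c • pauliW u) * (d • pauliW w), ?_, ?_, ?_⟩
  · rw [hprod]
    exact mem_pauliGroup_iff.2 ⟨_, hmem, _, rfl⟩
  · rw [hprod, supportedOn_pauliW_iff]
    · intro q hq
      exact hclean q (not_not.1 hq)
    · intro h0
      have := norm_of_mem_pauliPhases hmem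
      rw [h0] at this
      simp at this
  · rw [Matrix.mul_assoc, hE.closure_mul hw, hPE]

/-- The range of `E` is the whole code space, so `U * E` factors through `E`; the factor is
recovered by applying the adjoint of `E`. -/
theorem IsLogicalGate.intertwines {U : QOp Q} (hE : IsEncoding T E) (hU : IsLogicalGate T U) :
    U * E = E * logicalAction E U := by
  refine Matrix.toLin'.injective (LinearMap.ext fun x => ?_)
  have hx : Matrix.toLin' E x ∈ codeSpace T := hE.2.1 ▸ LinearMap.mem_range_self _ x
  have hUx : Matrix.toLin' U (Matrix.toLin' E x) ∈ codeSpace T :=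
    hU.2 ▸ Submodule.mem_map_of_mem hx
  rw [← hE.2.1] at hUx
  obtain ⟨y, hy⟩ := hUx
  have hEE : Matrix.toLin' E.conjTranspose (Matrix.toLin' E y) = y := by
    rw [← LinearMap.comp_apply, ← Matrix.toLin'_mul, hE.1, Matrix.toLin'_one, LinearMap.id_apply]
  simp only [logicalAction, Matrix.toLin'_mul, LinearMap.comp_apply]
  rw [← hy, hEE]

theorem unitary_of_intertwines {U : QOp Q} (hU : U ∈ Matrix.unitaryGroup (Q → Fin 2) ℂ)
    (hE : IsEncoding T E) {L : QOp (Fin m)} (h : U * E = E * L) :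
    L ∈ Matrix.unitaryGroup (Fin m → Fin 2) ℂ := by
  rw [Matrix.mem_unitaryGroup_iff', Matrix.star_eq_conjTranspose]
  calc L.conjTranspose * L = L.conjTranspose * (E.conjTranspose * E) * L := by
        rw [hE.1, Matrix.mul_one]
    _ = (E * L).conjTranspose * (E * L) := by
        rw [Matrix.conjTranspose_mul]; simp only [Matrix.mul_assoc]
    _ = E.conjTranspose * (U.conjTranspose * U) * E := by
        rw [← h, Matrix.conjTranspose_mul]; simp only [Matrix.mul_assoc]
    _ = 1 := by rw [conjTranspose_mul_of_unitary hU, Matrix.mul_one, hE.1]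

theorem conjTranspose_intertwines {U : QOp Q} (hU : U ∈ Matrix.unitaryGroup (Q → Fin 2) ℂ)
    (hE : IsEncoding T E) {L : QOp (Fin m)} (h : U * E = E * L) :
    U.conjTranspose * E = E * L.conjTranspose := by
  have hL := unitary_of_intertwines hU hE h
  calc U.conjTranspose * E = U.conjTranspose * (E * L) * L.conjTranspose := by
        rw [Matrix.mul_assoc, Matrix.mul_assoc, mul_conjTranspose_of_unitary hL, Matrix.mul_one]
    _ = (U.conjTranspose * U) * E * L.conjTranspose := by
        rw [← h]; simp only [Matrix.mul_assoc]
    _ = E * L.conjTranspose := by rw [conjTranspose_mul_of_unitary hU, Matrix.one_mul]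

end Logical

/-! ### Descent through the hierarchy by commutators -/

section Levels

variable {V : Type*} [Fintype V] [DecidableEq V] {K : ℕ} {T : Set (QOp (Fin K × V))} {m : ℕ}
  {E : Matrix (Fin K × V → Fin 2) (Fin m → Fin 2) ℂ}

/-- A logical gate of range `r` supported on `l + 1` regions whose neighbourhoods are correctable
acts on the logical qubits in level `l`. -/
theorem mem_commutatorLevel_of_supportedOn {G : SimpleGraph V} (hG : G.Connected)
    (hT : T ⊆ pauliGroup (Fin K × V)) (hE : IsEncoding T E) {b : ℕ} {F : ℕ → Set V} (l : ℕ)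
    (hF : ∀ j, Correctable T (cyl K (nbhd G b (F j)))) :
    ∀ (r : ℕ) (U : QOp (Fin K × V)) (L : QOp (Fin m)), HasRange G r U → 2 ^ l * r ≤ b →
      SupportedOn U (cyl K {v | ∃ j < l + 1, v ∈ F j}) → U * E = E * L →
      L ∈ commutatorLevel (Fin m) l := by
  induction l with
  | zero =>
    intro r U L hU _ hsupp hUE
    have hL := unitary_of_intertwines hU.1 hE hUE
    -- Each logical Pauli operator has a representative off the only region carrying `U`, so it
    -- commutes with `U`.
    have hcomm : ∀ v, Commute L (pauliW v) := by
      intro v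
      obtain ⟨P, -, hPs, hPE⟩ := hE.exists_clean hT (hF 0) v
      have hdisj : Disjoint (cyl K {v | ∃ j < 0 + 1, v ∈ F j}) (cyl K (nbhd G b (F 0)))ᶜ := by
        rw [Set.disjoint_left]
        rintro p ⟨j, hj, hp⟩ hp'
        obtain rfl : j = 0 := by omega
        exact hp' (subset_nbhd b (F 0) hp)
      have hUP : U * P = P * U := hsupp.commute hPs hdisj
      refine hE.left_cancel ?_
      calc E * (L * pauliW v) = U * E * pauliW v := by rw [hUE, Matrix.mul_assoc]
        _ = U * P * E := by rw [Matrix.mul_assoc, ← hPE, Matrix.mul_assoc]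
        _ = P * E * L := by rw [hUP, Matrix.mul_assoc, hUE, Matrix.mul_assoc]
        _ = E * (pauliW v * L) := by rw [hPE, Matrix.mul_assoc]
    obtain ⟨c, rfl⟩ := eq_smul_one_of_commute fun q u => hcomm (Pi.single q u)
    exact ⟨c, norm_eq_one_of_smul_unitary hL, rfl⟩
  | succ l ih =>
    intro r U L hU hr hsupp hUE
    refine ⟨unitary_of_intertwines hU.1 hE hUE, fun v => ?_⟩
    obtain ⟨P, hP, hPs, hPE⟩ := hE.exists_clean hT (hF (l + 1)) v
    have hPu := pauliGroup_unitary hP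
    have hP' := pauliGroup_conjTranspose hP
    have hPE' := conjTranspose_intertwines hPu hE hPE
    rw [pauliW_conjTranspose] at hPE'
    have hUE' := conjTranspose_intertwines hU.1 hE hUE
    -- Pauli operators have range `0`, so the commutator has range `2 * r`. The factor `2 ^ l` in
    -- the hypothesis pays for this doubling at every stage.
    refine ih (r + 0 + r + 0) (U * P * U.conjTranspose * P.conjTranspose) _
      (((hU.mul hG (hasRange_pauli G hP)).mul hG hU.conjTranspose).mul hG (hasRange_pauli G hP'))
      ?_ ?_ ?_
    · calc 2 ^ l * (r + 0 + r + 0) = 2 ^ (l + 1) * r := by ring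
        _ ≤ b := hr
    · have h1 : SupportedOn (U * P * U.conjTranspose * P.conjTranspose)
          -- Read as `U * (P * U† * P†)`: conjugation by a Pauli operator does not enlarge supports,
          -- so both factors stay over the regions of `U`.
          (cyl K {v | ∃ j < l + 1 + 1, v ∈ F j}) := by
        have h := hsupp.mul (hsupp.conjTranspose.conj_pauli hP)
        simpa only [mul_assoc] using h
      -- Read as `(U * P * U†) * P†`: since `P` avoids the `b`-neighbourhood of the last region and
      -- `r ≤ b`, its spread image still avoids the region itself.
      have h2 : SupportedOn (U * P * U.conjTranspose * P.conjTranspose)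
          (cyl K (F (l + 1))ᶜ) := by
        have hrb : r ≤ b := le_trans (Nat.le_mul_of_pos_left r (by positivity)) hr
        have hPs' : SupportedOn P (cyl K (nbhd G b (F (l + 1)))ᶜ) := hPs
        refine ((hU.2 _ P hPs').1.mono ?_).mul (hPs.conjTranspose.mono ?_)
        · rintro p ⟨u, hu, hup⟩ hp
          exact hu ⟨p.2, hp, by rw [SimpleGraph.dist_comm]; omega⟩
        · intro p hp hp'
          exact hp (subset_nbhd b _ hp')
      refine (h1.inter h2).mono ?_
      rintro p ⟨⟨j, hj, hp⟩, hp2⟩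
      have hne : j ≠ l + 1 := by
        rintro rfl
        exact hp2 hp
      exact ⟨j, by omega, hp⟩
    · calc U * P * U.conjTranspose * P.conjTranspose * E
          = U * (P * (U.conjTranspose * (P.conjTranspose * E))) := by
            simp only [Matrix.mul_assoc]
        _ = U * (P * (U.conjTranspose * E * pauliW v)) := by
            rw [hPE']; simp only [Matrix.mul_assoc]
        _ = U * (P * E * L.conjTranspose * pauliW v) := by
            rw [hUE']; simp only [Matrix.mul_assoc]
        _ = U * E * (pauliW v * L.conjTranspose * pauliW v) := by
            rw [hPE]; simp only [Matrix.mul_assoc]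
        _ = E * (L * pauliW v * L.conjTranspose * pauliW v) := by
            rw [hUE]; simp only [Matrix.mul_assoc]

end Levels

/-- Graph-local and virtually graph-local gates have supports of uniformly bounded projected
diameter. -/
theorem exists_isShortGate {I : Type*} {V : I → Type*} [∀ i, Fintype (V i)]
    [∀ i, DecidableEq (V i)] {S : ∀ i, Set (QOp (V i))}
    (hconn : ∀ i, (connectivityGraph (S i)).Connected) {K : ℕ}
    {𝒢 : ∀ i, Set (QOp (V i))} (h𝒢 : IsGraphLocal S 𝒢)
    {𝒢' : ∀ i, Set (QOp (Fin K × V i))} (h𝒢' : IsVirtuallyGraphLocal S 𝒢') :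
    ∃ r : ℕ, ∀ i, ∀ g ∈ multiBlockGates (𝒢 i) (𝒢' i),
      IsShortGate (connectivityGraph (S i)) r g := by
  obtain ⟨hu, η, hη⟩ := h𝒢
  obtain ⟨hu', η', hη'⟩ := h𝒢'
  refine ⟨η + 2 * η', fun i g hg => ?_⟩
  rcases hg with ⟨j, g, hg, rfl⟩ | hg
  · refine ⟨blockOp_unitary j (hu i g hg), fun p hp q hq => ?_⟩
    have h := hη i g hg _ (support_blockOp_subset j g hp).2 _ (support_blockOp_subset j g hq).2
    rw [← (hconn i _ _).coe_dist_eq_edist] at h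
    have h' : (connectivityGraph (S i)).dist p.2 q.2 ≤ η := by exact_mod_cast h
    omega
  · obtain ⟨hgu, p₀, hp₀, q₀, hq₀, hne⟩ := hu' i g hg
    have key : ∀ p ∈ support g, ∀ q ∈ support g, p.1 ≠ q.1 →
        (connectivityGraph (S i)).dist p.2 q.2 ≤ η' := by
      intro p hp q hq hpq
      have h := hη' i p q ⟨hpq, g, hg, hp, hq⟩
      rw [edgeWeight, if_neg hpq] at h
      omega
    refine ⟨hgu, fun p hp q hq => ?_⟩
    by_cases hpq : p.1 = q.1
    -- Virtual edges join different blocks only. Two qubits of one block are compared through a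
    -- third qubit of the gate in another block, at a cost of `2 * η'`.
    · obtain ⟨t, ht, htp⟩ : ∃ t ∈ support g, p.1 ≠ t.1 := by
        by_cases h : p.1 = p₀.1
        · exact ⟨q₀, hq₀, fun h' => hne (h.symm.trans h')⟩
        · exact ⟨p₀, hp₀, h⟩
      have h1 := key p hp t ht htp
      have h2 := key t ht q hq fun h => htp (hpq.trans h.symm)
      have := (hconn i).dist_triangle (u := p.2) (v := t.2) (w := q.2)
      omega
    · have := key p hp q hq hpq
      omega

end QCode

/-! ### Choice of the constants and conclusion -/

theorem mainTheorem3 {I : Type*} {V : I → Type*} [∀ i, Fintype (V i)] [∀ i, DecidableEq (V i)]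
    (S : ∀ i, Set (QCode.QOp (V i)))
    (hS : ∀ i, QCode.IsStabilizerGeneratingSet (S i))
    (hconn : ∀ i, (QCode.connectivityGraph (S i)).Connected)
    (β : ℝ≥0∞) (hβ : QCode.intrinsicDim S = β)
    (K : ℕ) (hK : 1 ≤ K)
    (𝒢 : ∀ i, Set (QCode.QOp (V i))) (h𝒢 : QCode.IsGraphLocal S 𝒢)
    (𝒢' : ∀ i, Set (QCode.QOp (Fin K × V i))) (h𝒢' : QCode.IsVirtuallyGraphLocal S 𝒢') :
    QCode.multiBlockIntrinsicDim S 𝒢' = β ∧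
    (β ≠ ⊤ → ∀ h : ℕ, ∃ d₀ : ℕ, ∀ i, (d₀ : ℕ∞) ≤ QCode.codeDistance (S i) →
      ∀ U : QCode.QOp (Fin K × V i),
        QCode.IsCircuit (QCode.multiBlockGates (𝒢 i) (𝒢' i)) h U →
        QCode.IsLogicalGate (QCode.blockCopies K (S i)) U →
        ∀ (m : ℕ) (E : Matrix (Fin K × V i → Fin 2) (Fin m → Fin 2) ℂ),
          QCode.IsEncoding (QCode.blockCopies K (S i)) E →
          ∃ z : ℂ, ‖z‖ = 1 ∧
            z • QCode.logicalAction E U ∈ QCode.cliffordLevel (Fin m) ⌊β.toReal⌋₊) := by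
  refine ⟨(QCode.multiBlockIntrinsicDim_eq S hconn hK 𝒢').trans hβ, fun hfin h => ?_⟩
  obtain ⟨r, hr⟩ := QCode.exists_isShortGate hconn h𝒢 h𝒢'
  have hlt : QCode.intrinsicDim S < ((⌊β.toReal⌋₊ + 1 : ℕ) : ℝ≥0∞) := by
    rw [hβ, ← ENNReal.ofReal_toReal hfin, ← ENNReal.ofReal_natCast]
    refine (ENNReal.ofReal_lt_ofReal_iff (by positivity)).2 ?_
    push_cast
    rw [ENNReal.toReal_ofReal ENNReal.toReal_nonneg]
    exact Nat.lt_floor_add_one _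
  set l := ⌊β.toReal⌋₊
  -- A circuit of depth `h` has range `h * r`, which doubles at each of `l` commutators. Separation
  -- more than `2 * b + 1` leaves the `b`-neighbourhoods non-adjacent, with pieces of radius `R +
  -- b`; the bound `M` on the size of such balls serves as `d₀`.
  set b := 2 ^ l * (h * r) with hb
  obtain ⟨R, hR⟩ := QCode.exists_uniform_fragmented_cover hconn hlt (2 * b + 1)
  obtain ⟨M, hM⟩ := QCode.exists_ball_bound hconn (hlt.trans (ENNReal.natCast_lt_top _)) (R + b)
  refine ⟨M, fun i hi U hU hUlog m E hE => ?_⟩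
  obtain ⟨F, hF, hcov⟩ := hR i
  refine QCode.exists_smul_mem_cliffordLevel ?_
  exact QCode.mem_commutatorLevel_of_supportedOn (hconn i)
    (QCode.blockCopies_subset_pauliGroup (hS i).1) hE l
    (fun j => ((hF j).nbhd (hconn i)).correctable (hS i).1 hi (hM i)) (h * r) U _
    (QCode.hasRange_circuit (hconn i) (hr i) hU) hb.ge
    -- The `l + 1` regions cover all vertices, so the support condition on `U` is vacuous.
    (fun p hp => absurd (hcov p.2) hp) (hUlog.intertwines hE)
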